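/- Let $V$ be a vector space over $\mathbb{F}_2$, possibly of infinite dimension. Let $D\subseteq \mathrm{GL}(V)$ be a set of elements of order $3$ such that the commutator space $[V,d]=\{vd-v\mid v\in V\}$ is $2$-dimensional for all $d\in D$, let $G=\langle D\rangle$, and suppose that $D$ is closed under conjugation by $G$. Suppose $[V,G]=V$ and $C_V(G)=\{0\}$, where $[V,G]$ is the span of all $[V,g]$, $g\in G$, and $C_V(G)$ is the space of vectors fixed by $G$. Let $\mathcal{L}=\{[V,d]\mid d\in D\}$. Suppose that there are no $D$-points, that is, no two distinct members of $\mathcal{L}$ intersect in a $1$-dimensional space. A *spread* of a $4$-dimensional subspace $W\le V$ is a set of five $2$-dimensional subspaces of $W$ pairwise intersecting in $\{0\}$. It is *full* if all five members are in $\mathcal{L}$. A *tangent spread* is a spread of a subspace $W=[V,\langle d,e\rangle]$, with $d,e\in D$, $[V,d]\ne[V,e]$ and $[V,e]\not\subseteq C_V(d)$, such that $W$ contains exactly four members of $\mathcal{L}$ and all four belong to the spread. Let $\Delta$ be the geometry whose points are the members of $\mathcal{L}$ and whose lines are the full and tangent spreads, each identified with the set of members of $\mathcal{L}$ it contains. **Theorem.**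 Suppose that $\Delta$ is connected, that $G$ is transitive on $\mathcal{L}$, and that there is a full spread. Then $\Delta$ is a projective space of order $4$: every line of $\Delta$ has exactly five points, any two distinct points are on a unique line, and the Veblen–Young axiom holds. Moreover $V$ carries the structure $V_4$ of a vector space over $\mathbb{F}_4$ (extending its $\mathbb{F}_2$-structure) such that $\Delta$ is the projective space of $V_4$: the members of $\mathcal{L}$ are exactly the $1$-dimensional $\mathbb{F}_4$-subspaces of $V_4$, and the lines of $\Delta$ are exactly the sets of all $1$-dimensional subspaces contained in a $2$-dimensional $\mathbb{F}_4$-subspace of $V_4$. The group $G$ preserves this structure, that is, it consists of $\mathbb{F}_4$-linear maps. Finally, there is a subspace $\Phi\le V_4^*$ annihilating $V_4$, i.e. $\bigcap_{\varphi\in\Phi}\ker\varphi=\{0\}$, such that $G=\mathrm{R}(V_4,\Phi)$ (in particular $G\cong \mathrm{R}(V_4,\Phi)$), where $\mathrm{R}(V_4,\Phi)$ is the subgroup of $\mathrm{GL}(V_4)$ generated by all reflections $r_{v,\varphi}:w\mapsto w-\varphi(w)v$ with $v\in V_4$, $\varphi\in\Phi$, $\varphi(v)\ne 0,1$. -/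

import Mathlib

namespace F2Group

section Basic

variable {V : Type*} [AddCommGroup V] [Module (ZMod 2) V]

/-- The commutator space `[V, d] = {v d - v | v ∈ V}`. -/
def commSpace (d : V ≃ₗ[ZMod 2] V) : Submodule (ZMod 2) V :=
  LinearMap.range ((d : V →ₗ[ZMod 2] V) - LinearMap.id)

/-- The centralizer `C_V(d)`, the space of vectors fixed by `d`. -/
def fixSpace (d : V ≃ₗ[ZMod 2] V) : Submodule (ZMod 2) V :=
  LinearMap.ker ((d : V →ₗ[ZMod 2] V) - LinearMap.id)

/-- `[V, G]`, the span of all `[V, g]` with `g ∈ G`. -/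
def groupCommSpace (G : Subgroup (V ≃ₗ[ZMod 2] V)) : Submodule (ZMod 2) V :=
  ⨆ g ∈ G, commSpace g

/-- `C_V(G)`, the space of vectors fixed by all of `G`. -/
def groupFixSpace (G : Subgroup (V ≃ₗ[ZMod 2] V)) : Submodule (ZMod 2) V :=
  ⨅ g ∈ G, fixSpace g

/-- The set of `D`-lines: the subspaces `[V, d]` with `d ∈ D`. -/
def dLines (D : Set (V ≃ₗ[ZMod 2] V)) : Set (Submodule (ZMod 2) V) :=
  {l | ∃ d ∈ D, l = commSpace d}

/-- The set of `D`-points: the 1-spaces that are the intersection of two distinct `D`-lines. -/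
def dPoints (D : Set (V ≃ₗ[ZMod 2] V)) : Set (Submodule (ZMod 2) V) :=
  {p | Module.finrank (ZMod 2) p = 1 ∧ ∃ l ∈ dLines D, ∃ m ∈ dLines D, l ≠ m ∧ p = l ⊓ m}

/-- `S` is a spread of the 4-dimensional space `W`: a set of five 2-dimensional subspaces of `W`
that pairwise intersect in zero. -/
structure IsSpreadOf (W : Submodule (ZMod 2) V) (S : Set (Submodule (ZMod 2) V)) : Prop where
  finrank_eq_four : Module.finrank (ZMod 2) W = 4
  ncard_eq_five : S.ncard = 5
  le : ∀ l ∈ S, l ≤ W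
  finrank_eq_two : ∀ l ∈ S, Module.finrank (ZMod 2) l = 2
  inf_eq_bot : ∀ l ∈ S, ∀ m ∈ S, l ≠ m → l ⊓ m = ⊥

/-- A full spread: a spread of some 4-space all of whose five members are `D`-lines. -/
def IsFullSpread (D : Set (V ≃ₗ[ZMod 2] V)) (S : Set (Submodule (ZMod 2) V)) : Prop :=
  ∃ W, IsSpreadOf W S ∧ S ⊆ dLines D

/-- A tangent spread: for some `d, e ∈ D` with `[V, d] ≠ [V, e]` and `[V, e]` not contained in
`C_V(d)`, the space `W = [V, ⟨d, e⟩]` contains exactly four `D`-lines, and `S` is a spread of `W`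
containing these four lines. -/
def IsTangentSpread (D : Set (V ≃ₗ[ZMod 2] V)) (S : Set (Submodule (ZMod 2) V)) : Prop :=
  ∃ d ∈ D, ∃ e ∈ D, commSpace d ≠ commSpace e ∧ ¬ commSpace e ≤ fixSpace d ∧
    {l ∈ dLines D | l ≤ groupCommSpace (Subgroup.closure {d, e})}.ncard = 4 ∧
    IsSpreadOf (groupCommSpace (Subgroup.closure {d, e})) S ∧
    {l ∈ dLines D | l ≤ groupCommSpace (Subgroup.closure {d, e})} ⊆ S

/-- The lines of the geometry `Δ`, whose points are the `D`-lines: the full and tangent spreads,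
each identified with the set of `D`-lines it contains. -/
def deltaLines (D : Set (V ≃ₗ[ZMod 2] V)) : Set (Set (Submodule (ZMod 2) V)) :=
  {b | ∃ S, (IsFullSpread D S ∨ IsTangentSpread D S) ∧ b = S ∩ dLines D}

end Basic

section Geometry

variable {α : Type*}

/-- The point-line geometry with point set `P` and line set `B` is connected: any two points
are joined by a path of successively collinear points. -/
def IsConnectedGeometry (P : Set α) (B : Set (Set α)) : Prop :=
  ∀ p ∈ P, ∀ q ∈ P, Relation.ReflTransGen (fun x y => ∃ b ∈ B, x ∈ b ∧ y ∈ b) p q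

/-- The point-line geometry with point set `P` and line set `B` is a projective space of order
`n`: lines are sets of `n + 1` points, two distinct points are on exactly one line, and the
axiom of Veblen and Young holds: if `b₁ ≠ b₂` are lines on a point `p`, and `c₁`, `c₂` are lines
each meeting both `b₁` and `b₂` in points different from `p`, then `c₁` and `c₂` meet. -/
structure IsProjectiveSpaceOfOrder (P : Set α) (B : Set (Set α)) (n : ℕ) : Prop where
  subset : ∀ b ∈ B, b ⊆ P
  ncard : ∀ b ∈ B, b.ncard = n + 1
  existsUnique_line : ∀ p ∈ P, ∀ q ∈ P, p ≠ q → ∃! b, b ∈ B ∧ p ∈ b ∧ q ∈ b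
  veblen_young : ∀ p ∈ P, ∀ b₁ ∈ B, ∀ b₂ ∈ B, b₁ ≠ b₂ → p ∈ b₁ → p ∈ b₂ →
    ∀ c₁ ∈ B, ∀ c₂ ∈ B,
      (∃ x ∈ c₁ ∩ b₁, x ≠ p) → (∃ x ∈ c₁ ∩ b₂, x ≠ p) →
      (∃ x ∈ c₂ ∩ b₁, x ≠ p) → (∃ x ∈ c₂ ∩ b₂, x ≠ p) →
      (c₁ ∩ c₂).Nonempty

end Geometry

/-- The field with four elements. -/
abbrev F4 : Type := GaloisField 2 2

section Reflections

variable {V : Type*} [AddCommGroup V] [Module F4 V]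

/-- The group `R(V₄, Φ)`: the subgroup of `GL(V₄)` generated by the reflections
`r_{v,φ} : w ↦ w - φ(w) v` with `v ∈ V₄`, `φ ∈ Φ` and `φ(v) ≠ 0, 1`. -/
noncomputable def reflectionGroup (Φ : Submodule F4 (Module.Dual F4 V)) : Subgroup (V ≃ₗ[F4] V) :=
  Subgroup.closure
    {g | ∃ v : V, ∃ φ ∈ Φ, φ v ≠ 0 ∧ φ v ≠ 1 ∧ ∀ w, g w = w - φ w • v}

/-- The inclusion of `GL(V₄)` in `GL(V)`, where `V` is `V₄` considered as a space over the field
with two elements. -/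
noncomputable def restrictHom (V : Type*) [AddCommGroup V] [Module (ZMod 2) V] [Module F4 V]
    [IsScalarTower (ZMod 2) F4 V] : (V ≃ₗ[F4] V) →* (V ≃ₗ[ZMod 2] V) where
  toFun g := g.restrictScalars (ZMod 2)
  map_one' := rfl
  map_mul' _ _ := rfl

end Reflections

end F2Group

/-! Without `D`-points, two `D`-lines sharing a nonzero vector coincide. Let `f` in `G` act
trivially on `V/k` for a `D`-line `k`. If `f` fixes a nonzero vector of a `D`-line `m ≠ k`, then `f
m = m`, so `(f - 1) m ≤ m ⊓ k = 0` and `f` fixes `m` pointwise. This rigidity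
(`le_fixSpace_of_apply_eq`) drives the combinatorial half of the proof.

The heart is `moves_of_ne`: transvections in `G` with center `l` move every other `D`-line. If they
move `m`, they are transitive on the `D`-lines other than `l` in `l ⊔ m`, which therefore cover it
together with `l`. Moving is symmetric: a one-sided pair is carried along by all of `G`
(`dominates_act`), and transitivity of `G` would produce a line moved by transvections at itself.
Conversely every full span contains a moving pair (`exists_moves_of_isFull`). If non-commuting
reflections had a span that is not full, a nonzero vector of it would be fixed by all of `G`
(`isFull_of_not_le_fixSpace`), so `C_V(G) = 0` rules out tangent spreads. Finally moving is
transitive between distinct lines (`moves_trans`), and connectedness of `Δ` does the rest.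

Now any two `D`-lines have a full span, so the union of the `D`-lines is a subspace and equals `[V,
G] = V`; the Veblen–Young axiom is a dimension count. For a fixed reflection `d` at `l`, the maps `g
- 1` for suitable `g` with center `l` behave like linear functionals with values in `l`, on which
`d` acts as a scalar. Transporting this scalar to `V` gives `J` with `J² = J + 1` preserving all
`D`-lines (`exists_endomorphism`). Elements of `G` either commute with `J` or interchange `J` and `J
+ 1`; elements of order three cannot do the latter, so `G` is linear over the field of order four.

Over that field the members of `D` are maps `w ↦ w + δ(w) v`. The functionals of the reflections and
transvections at `v` span a subspace of the dual that does not depend on `v` (`dualSubmodule_le`);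
this subspace is `Φ`. -/

namespace F2Group

/-! ### Transvections, axial elements and the action on subspaces -/

section Configuration

variable {V : Type*} [AddCommGroup V] [Module (ZMod 2) V]

/-- A group `G` generated by a normal set `D` of elements of order three with two-dimensional
commutator space, without `D`-points. -/
structure IsLineConfiguration (G : Subgroup (V ≃ₗ[ZMod 2] V)) (D : Set (V ≃ₗ[ZMod 2] V)) :
    Prop where
  closure_eq : Subgroup.closure D = G
  conj_mem : ∀ g ∈ G, ∀ d ∈ D, g * d * g⁻¹ ∈ D
  orderOf_eq : ∀ d ∈ D, orderOf d = 3
  finrank_eq : ∀ d ∈ D, Module.finrank (ZMod 2) (commSpace d) = 2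
  dPoints_eq : dPoints D = ∅

/-- The image of a subspace under a linear automorphism. -/
def act (g : V ≃ₗ[ZMod 2] V) (l : Submodule (ZMod 2) V) : Submodule (ZMod 2) V :=
  l.map (g : V →ₗ[ZMod 2] V)

/-- The elements of `D` with commutator space `l`. -/
def centeredAt (D : Set (V ≃ₗ[ZMod 2] V)) (l : Submodule (ZMod 2) V) :
    Set (V ≃ₗ[ZMod 2] V) :=
  {d | d ∈ D ∧ commSpace d = l}

/-- The elements of `G` that act trivially on `l` and on the quotient by `l`. -/
def transvections (G : Subgroup (V ≃ₗ[ZMod 2] V)) (l : Submodule (ZMod 2) V) :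
    Set (V ≃ₗ[ZMod 2] V) :=
  {t | t ∈ G ∧ (∀ v, t v - v ∈ l) ∧ l ≤ fixSpace t}

/-- Some transvection with center `l` moves `m`. -/
def Moves (G : Subgroup (V ≃ₗ[ZMod 2] V)) (l m : Submodule (ZMod 2) V) : Prop :=
  ∃ t ∈ transvections G l, ¬ m ≤ fixSpace t

/-- An element of `G` acting trivially on the quotient by `k`, and either trivially or without
fixed points on `k`. -/
structure IsAxial (G : Subgroup (V ≃ₗ[ZMod 2] V)) (k : Submodule (ZMod 2) V)
    (f : V ≃ₗ[ZMod 2] V) : Prop where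
  mem : f ∈ G
  sub_mem : ∀ v, f v - v ∈ k
  fix : k ≤ fixSpace f ∨ ∀ v ∈ k, f v = v → v = 0

/-- Every vector of `l ⊔ m` lies in a `D`-line contained in `l ⊔ m`. -/
def IsFull (D : Set (V ≃ₗ[ZMod 2] V)) (l m : Submodule (ZMod 2) V) : Prop :=
  ∀ v ∈ l ⊔ m, ∃ p ∈ dLines D, p ≤ l ⊔ m ∧ v ∈ p

theorem mem_fixSpace {g : V ≃ₗ[ZMod 2] V} {v : V} : v ∈ fixSpace g ↔ g v = v := by
  simp [fixSpace, sub_eq_zero]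

theorem mem_commSpace {g : V ≃ₗ[ZMod 2] V} {x : V} : x ∈ commSpace g ↔ ∃ v, g v - v = x := by
  simp [commSpace]

theorem mem_act {g : V ≃ₗ[ZMod 2] V} {l : Submodule (ZMod 2) V} {x : V} :
    x ∈ act g l ↔ g⁻¹ x ∈ l := by
  constructor
  · rintro ⟨y, hy, rfl⟩
    have : g⁻¹ (g y) = y := g.symm_apply_apply y
    simpa [this] using hy
  · intro h
    exact ⟨g⁻¹ x, h, g.apply_symm_apply x⟩

theorem apply_mem_act {g : V ≃ₗ[ZMod 2] V} {l : Submodule (ZMod 2) V} {x : V} (h : x ∈ l) :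
    g x ∈ act g l := ⟨x, h, rfl⟩

theorem inv_apply_self' (g : V ≃ₗ[ZMod 2] V) (x : V) : g⁻¹ (g x) = x := g.symm_apply_apply x

theorem apply_inv_self' (g : V ≃ₗ[ZMod 2] V) (x : V) : g (g⁻¹ x) = x := g.apply_symm_apply x

theorem act_mono (g : V ≃ₗ[ZMod 2] V) {l m : Submodule (ZMod 2) V} (h : l ≤ m) :
    act g l ≤ act g m := Submodule.map_mono h

theorem act_sup (g : V ≃ₗ[ZMod 2] V) (l m : Submodule (ZMod 2) V) :
    act g (l ⊔ m) = act g l ⊔ act g m := Submodule.map_sup _ _ _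

theorem act_mul (g h : V ≃ₗ[ZMod 2] V) (l : Submodule (ZMod 2) V) :
    act (g * h) l = act g (act h l) := by
  ext x; simp [mem_act]

theorem act_inv_act (g : V ≃ₗ[ZMod 2] V) (l : Submodule (ZMod 2) V) :
    act g⁻¹ (act g l) = l := by
  ext x; simp [mem_act, inv_apply_self']

theorem act_act_inv (g : V ≃ₗ[ZMod 2] V) (l : Submodule (ZMod 2) V) :
    act g (act g⁻¹ l) = l := by
  ext x; simp [mem_act]

theorem act_injective (g : V ≃ₗ[ZMod 2] V) : Function.Injective (act g) :=
  Function.LeftInverse.injective (act_inv_act g)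

theorem act_eq_self {g : V ≃ₗ[ZMod 2] V} {l : Submodule (ZMod 2) V} (h : l ≤ fixSpace g) :
    act g l = l := by
  ext x
  rw [mem_act]
  constructor
  · intro hx
    have := mem_fixSpace.1 (h hx)
    rw [apply_inv_self'] at this
    rwa [← this] at hx
  · intro hx
    have h1 := mem_fixSpace.1 (h hx)
    rwa [← h1, inv_apply_self']

theorem fixSpace_conj (g f : V ≃ₗ[ZMod 2] V) :
    fixSpace (g * f * g⁻¹) = act g (fixSpace f) := by
  ext x
  rw [mem_act, mem_fixSpace, mem_fixSpace]
  change g (f (g⁻¹ x)) = x ↔ _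
  constructor
  · intro h
    rw [← inv_apply_self' g (f _), h]
  · intro h
    rw [h, apply_inv_self']

theorem commSpace_conj (g f : V ≃ₗ[ZMod 2] V) :
    commSpace (g * f * g⁻¹) = act g (commSpace f) := by
  ext x
  rw [mem_act, mem_commSpace, mem_commSpace]
  constructor
  · rintro ⟨v, rfl⟩
    refine ⟨g⁻¹ v, ?_⟩
    change _ = g⁻¹ (g (f (g⁻¹ v)) - v)
    rw [map_sub, inv_apply_self']
  · rintro ⟨v, hv⟩
    refine ⟨g v, ?_⟩
    change g (f (g⁻¹ (g v))) - g v = x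
    rw [inv_apply_self', ← map_sub, hv, apply_inv_self']

theorem fixSpace_inv (g : V ≃ₗ[ZMod 2] V) : fixSpace g⁻¹ = fixSpace g := by
  ext x
  rw [mem_fixSpace, mem_fixSpace]
  constructor
  · intro h
    have := apply_inv_self' g x
    rwa [h] at this
  · intro h
    have := inv_apply_self' g x
    rwa [h] at this

theorem act_le_iff {g : V ≃ₗ[ZMod 2] V} {l m : Submodule (ZMod 2) V} :
    act g l ≤ act g m ↔ l ≤ m :=
  ⟨fun h => by simpa [act_inv_act] using act_mono g⁻¹ h, act_mono g⟩

theorem act_le_sup {t : V ≃ₗ[ZMod 2] V} {l m : Submodule (ZMod 2) V}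
    (h : ∀ v, t v - v ∈ l) : act t m ≤ l ⊔ m := by
  rintro _ ⟨v, hv, rfl⟩
  have : t v = (t v - v) + v := by abel
  change t v ∈ _
  rw [this]
  exact Submodule.add_mem_sup (h v) hv

end Configuration

/-! ### Rigidity of axial elements -/

namespace IsLineConfiguration

variable {V : Type*} [AddCommGroup V] [Module (ZMod 2) V]
  {G : Subgroup (V ≃ₗ[ZMod 2] V)} {D : Set (V ≃ₗ[ZMod 2] V)}
  {k l m p q x y : Submodule (ZMod 2) V} {d e f g h t : V ≃ₗ[ZMod 2] V}

theorem mem_of_mem (hC : IsLineConfiguration G D) (hd : d ∈ D) : d ∈ G :=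
  hC.closure_eq ▸ Subgroup.subset_closure hd

theorem mem_group (hC : IsLineConfiguration G D) (hd : d ∈ centeredAt D l) : d ∈ G :=
  hC.mem_of_mem hd.1

theorem mem_dLines_of_mem (hd : d ∈ centeredAt D l) : l ∈ dLines D := ⟨d, hd.1, hd.2.symm⟩

theorem exists_mem_centeredAt (hl : l ∈ dLines D) : ∃ d, d ∈ centeredAt D l := by
  obtain ⟨d, hd, rfl⟩ := hl
  exact ⟨d, hd, rfl⟩

theorem sub_mem_of_mem (hd : d ∈ centeredAt D l) (v : V) : d v - v ∈ l := by
  rw [← hd.2]; exact mem_commSpace.2 ⟨v, rfl⟩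

theorem finrank_dLine (hC : IsLineConfiguration G D) (hl : l ∈ dLines D) :
    Module.finrank (ZMod 2) l = 2 := by
  obtain ⟨d, hd, rfl⟩ := hl
  exact hC.finrank_eq d hd

theorem finiteDimensional_dLine (hC : IsLineConfiguration G D) (hl : l ∈ dLines D) :
    FiniteDimensional (ZMod 2) l :=
  Module.finite_of_finrank_pos (by rw [hC.finrank_dLine hl]; norm_num)

theorem exists_ne_zero (hC : IsLineConfiguration G D) (hl : l ∈ dLines D) :
    ∃ v ∈ l, v ≠ 0 := by
  have h : l ≠ ⊥ := by
    rintro rfl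
    have := hC.finrank_dLine hl
    simp at this
  exact (Submodule.ne_bot_iff l).1 h

theorem act_mem_dLines (hC : IsLineConfiguration G D) (hg : g ∈ G) (hl : l ∈ dLines D) :
    act g l ∈ dLines D := by
  obtain ⟨d, hd, rfl⟩ := hl
  exact ⟨_, hC.conj_mem g hg d hd, (commSpace_conj g d).symm⟩

theorem conj_mem_centeredAt (hC : IsLineConfiguration G D) (hg : g ∈ G)
    (hd : d ∈ centeredAt D l) : g * d * g⁻¹ ∈ centeredAt D (act g l) :=
  ⟨hC.conj_mem g hg d hd.1, by rw [commSpace_conj, hd.2]⟩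

theorem conj_mem_transvections (hg : g ∈ G) (ht : t ∈ transvections G l) :
    g * t * g⁻¹ ∈ transvections G (act g l) := by
  refine ⟨G.mul_mem (G.mul_mem hg ht.1) (G.inv_mem hg), fun v => ?_, ?_⟩
  · change g (t (g⁻¹ v)) - v ∈ _
    have : g (t (g⁻¹ v)) - v = g (t (g⁻¹ v) - g⁻¹ v) := by rw [map_sub, apply_inv_self']
    rw [this]
    exact apply_mem_act (ht.2.1 _)
  · rw [fixSpace_conj]
    exact act_mono g ht.2.2

theorem moves_act (hg : g ∈ G) (h : Moves G l m) : Moves G (act g l) (act g m) := by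
  obtain ⟨t, ht, hm⟩ := h
  exact ⟨_, conj_mem_transvections hg ht, by rwa [fixSpace_conj, act_le_iff]⟩

theorem cube_apply (hC : IsLineConfiguration G D) (hd : d ∈ centeredAt D l) (v : V) :
    d (d (d v)) = v := by
  have h : d ^ 3 = 1 := by rw [← hC.orderOf_eq d hd.1]; exact pow_orderOf_eq_one d
  have : (d ^ 3) v = v := by rw [h]; rfl
  simpa [pow_succ] using this

/-- On `l`, the image of `d - 1`, the operator `1 + d + d²` vanishes because `d³ = 1`. Thus `d` acts
on `l` like a generator of the field of order four. -/
theorem apply_apply_eq (hC : IsLineConfiguration G D) (hd : d ∈ centeredAt D l) {v : V}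
    (hv : v ∈ l) : d (d v) = d v + v := by
  rw [← hd.2, mem_commSpace] at hv
  obtain ⟨w, rfl⟩ := hv
  simp only [map_sub, hC.cube_apply hd]
  have h := ZModModule.add_self (d (d w))
  have h' := ZModModule.add_self w
  linear_combination (norm := module) h' - h

theorem eq_zero_of_apply_eq (hC : IsLineConfiguration G D) (hd : d ∈ centeredAt D l) {v : V}
    (hv : v ∈ l) (h : d v = v) : v = 0 := by
  have := hC.apply_apply_eq hd hv
  rw [h, h] at this
  simpa using this

theorem apply_mem (hd : d ∈ centeredAt D l) {v : V} (hv : v ∈ l) : d v ∈ l := by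
  have := l.add_mem (sub_mem_of_mem hd v) hv
  simpa using this

theorem isAxial_of_centeredAt (hC : IsLineConfiguration G D) (hd : d ∈ centeredAt D l) :
    IsAxial G l d :=
  ⟨hC.mem_group hd, sub_mem_of_mem hd, Or.inr fun _ hv h => hC.eq_zero_of_apply_eq hd hv h⟩

theorem isAxial_of_transvections (ht : t ∈ transvections G l) : IsAxial G l t :=
  ⟨ht.1, ht.2.1, Or.inl ht.2.2⟩

/-- The intersection has dimension 1 or 2. Dimension 1 would make it a `D`-point, and dimension 2
forces equality. -/
theorem eq_of_mem_of_mem (hC : IsLineConfiguration G D) (hl : l ∈ dLines D) (hm : m ∈ dLines D)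
    {v : V} (hv : v ≠ 0) (hvl : v ∈ l) (hvm : v ∈ m) : l = m := by
  by_contra hne
  have := hC.finiteDimensional_dLine hl
  have := hC.finiteDimensional_dLine hm
  have h2 := hC.finrank_dLine hl
  have h2' := hC.finrank_dLine hm
  have hpos : 0 < Module.finrank (ZMod 2) ↥(l ⊓ m) := by
    rw [Module.finrank_pos_iff_exists_ne_zero]
    exact ⟨⟨v, hvl, hvm⟩, by simpa [Subtype.ext_iff] using hv⟩
  have hle : Module.finrank (ZMod 2) ↥(l ⊓ m) ≤ 2 := (Submodule.finrank_mono inf_le_left).trans h2.le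
  have h1 : Module.finrank (ZMod 2) ↥(l ⊓ m) ≠ 2 := by
    intro h
    have e1 : l ⊓ m = l := Submodule.eq_of_le_of_finrank_eq inf_le_left (by rw [h, h2])
    have e2 : l ⊓ m = m := Submodule.eq_of_le_of_finrank_eq inf_le_right (by rw [h, h2'])
    exact hne (e1.symm.trans e2)
  have : l ⊓ m ∈ dPoints D := ⟨by omega, l, hl, m, hm, hne, rfl⟩
  rw [hC.dPoints_eq] at this
  exact this

theorem eq_of_le (hC : IsLineConfiguration G D) (hl : l ∈ dLines D) (hm : m ∈ dLines D)
    (h : l ≤ m) : l = m := by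
  obtain ⟨v, hv, h0⟩ := hC.exists_ne_zero hl
  exact hC.eq_of_mem_of_mem hl hm h0 hv (h hv)

theorem disjoint_dLines (hC : IsLineConfiguration G D) (hl : l ∈ dLines D) (hm : m ∈ dLines D)
    (h : l ≠ m) : l ⊓ m = ⊥ := by
  rw [eq_bot_iff]
  rintro v ⟨hvl, hvm⟩
  by_contra h0
  exact h (hC.eq_of_mem_of_mem hl hm h0 hvl hvm)

/-- A two-dimensional space over the field with two elements has three nonzero vectors. -/
theorem eq_or_eq_or_eq_add (h2 : Module.finrank (ZMod 2) l = 2) {u w z : V}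
    (hu : u ∈ l) (hw : w ∈ l) (hz : z ∈ l) (hu0 : u ≠ 0) (hw0 : w ≠ 0) (huw : u ≠ w)
    (hz0 : z ≠ 0) : z = u ∨ z = w ∨ z = u + w := by
  have : FiniteDimensional (ZMod 2) l := Module.finite_of_finrank_pos (by omega)
  have hcard : Nat.card l = 4 := by
    rw [Module.natCard_eq_pow_finrank (K := ZMod 2), h2]; simp
  have : Finite l := Nat.finite_of_card_ne_zero (by omega)
  have hc : (l : Set V).ncard = 4 := hcard
  have huw' : u + w ≠ 0 := by
    intro h
    apply huw
    have := ZModModule.add_self w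
    linear_combination (norm := module) h - this
  have hsub : ({0, u, w, u + w} : Set V) ⊆ (l : Set V) := by
    rintro a (rfl | rfl | rfl | rfl)
    exacts [l.zero_mem, hu, hw, l.add_mem hu hw]
  have hcard' : ({0, u, w, u + w} : Set V).ncard = 4 := by
    rw [Set.ncard_insert_of_notMem, Set.ncard_insert_of_notMem, Set.ncard_pair]
    · simpa using hu0
    · simp [huw, hw0]
    · simp [hu0.symm, hw0.symm, huw'.symm]
  have heq := Set.eq_of_subset_of_ncard_le hsub (by rw [hc, hcard']) (Set.toFinite _)
  have : z ∈ ({0, u, w, u + w} : Set V) := by rw [heq]; exact hz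
  simpa [hz0] using this

theorem eq_or_eq_apply (hC : IsLineConfiguration G D) (hd : d ∈ centeredAt D l) {u w : V}
    (hu : u ∈ l) (hw : w ∈ l) (hu0 : u ≠ 0) (hw0 : w ≠ 0) :
    w = u ∨ w = d u ∨ w = d (d u) := by
  rw [hC.apply_apply_eq hd hu, add_comm (d u)]
  exact eq_or_eq_or_eq_add (hC.finrank_dLine (mem_dLines_of_mem hd)) hu (apply_mem hd hu) hw hu0
    (by simpa using hu0) (fun h => hu0 (hC.eq_zero_of_apply_eq hd hu h.symm)) hw0

/-- For `m ≠ k`, the image `f m` is a `D`-line sharing `v` with `m`, hence equals `m`. Then `(f - 1)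
m` lies in `m ⊓ k`, which is zero. -/
theorem le_fixSpace_of_apply_eq (hC : IsLineConfiguration G D) (hf : IsAxial G k f)
    (hk : k ∈ dLines D) (hm : m ∈ dLines D) {v : V} (hv : v ∈ m) (h0 : v ≠ 0) (h : f v = v) :
    m ≤ fixSpace f := by
  by_cases hkm : m = k
  · subst hkm
    rcases hf.fix with h1 | h1
    · exact h1
    · exact absurd (h1 v hv h) h0
  · have hfm : act f m = m := hC.eq_of_mem_of_mem (hC.act_mem_dLines hf.mem hm) hm h0
      (by have := apply_mem_act (g := f) hv; rwa [h] at this) hv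
    intro x hx
    rw [mem_fixSpace, ← sub_eq_zero]
    by_contra hne
    have h1 : f x - x ∈ m := m.sub_mem (by have := apply_mem_act (g := f) hx; rwa [hfm] at this) hx
    exact hkm (hC.eq_of_mem_of_mem hm hk hne h1 (hf.sub_mem x))

theorem apply_ne (hC : IsLineConfiguration G D) (hf : IsAxial G k f)
    (hk : k ∈ dLines D) (hm : m ∈ dLines D) (hfm : ¬ m ≤ fixSpace f) {v : V} (hv : v ∈ m)
    (h0 : v ≠ 0) : f v ≠ v :=
  fun h => hfm (hC.le_fixSpace_of_apply_eq hf hk hm hv h0 h)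

/-- If `f` does not fix `m` then `f - 1` maps `m` onto the center of `f`. -/
theorem exists_sub_eq (hC : IsLineConfiguration G D) (hf : IsAxial G k f)
    (hk : k ∈ dLines D) (hm : m ∈ dLines D) (hfm : ¬ m ≤ fixSpace f) {x : V} (hx : x ∈ k) :
    ∃ v ∈ m, f v - v = x := by
  have := hC.finiteDimensional_dLine hk
  have := hC.finiteDimensional_dLine hm
  let φ : m →ₗ[ZMod 2] k := LinearMap.codRestrict k
    (((f : V →ₗ[ZMod 2] V) - LinearMap.id).comp m.subtype) (fun v => hf.sub_mem v)
  have hinj : Function.Injective φ := by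
    rw [injective_iff_map_eq_zero]
    intro v hv
    by_contra h0
    refine hC.apply_ne hf hk hm hfm v.2 (by simpa using h0) ?_
    exact sub_eq_zero.1 (congrArg Subtype.val hv : f v - v = 0)
  have hsurj := (LinearMap.injective_iff_surjective_of_finrank_eq_finrank
    (by rw [hC.finrank_dLine hk, hC.finrank_dLine hm])).1 hinj
  obtain ⟨v, hv⟩ := hsurj ⟨x, hx⟩
  exact ⟨v, v.2, congrArg Subtype.val hv⟩

/-- If `f` does not fix `m`, then an automorphism fixing `m` and `f⁻¹ m` fixes the center. -/
theorem le_of_le_of_act_le (hC : IsLineConfiguration G D) (hf : IsAxial G k f)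
    (hk : k ∈ dLines D) (hm : m ∈ dLines D) (hfm : ¬ m ≤ fixSpace f)
    {U : Submodule (ZMod 2) V} (h1 : m ≤ U) (h2 : act f m ≤ U) : k ≤ U := by
  intro x hx
  obtain ⟨v, hv, rfl⟩ := hC.exists_sub_eq hf hk hm hfm hx
  exact U.sub_mem (h2 (apply_mem_act hv)) (h1 hv)

theorem finrank_sup (hC : IsLineConfiguration G D) (hl : l ∈ dLines D) (hm : m ∈ dLines D)
    (h : l ≠ m) : Module.finrank (ZMod 2) ↥(l ⊔ m) = 4 := by
  have := hC.finiteDimensional_dLine hl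
  have := hC.finiteDimensional_dLine hm
  have := Submodule.finrank_sup_add_finrank_inf_eq l m
  rw [hC.disjoint_dLines hl hm h, hC.finrank_dLine hl, hC.finrank_dLine hm, finrank_bot] at this
  exact this

theorem sup_eq_sup (hC : IsLineConfiguration G D) (hl : l ∈ dLines D) (hm : m ∈ dLines D)
    (hx : x ∈ dLines D) (hy : y ∈ dLines D) (hlm : l ≠ m) (hxy : x ≠ y) (hx' : x ≤ l ⊔ m)
    (hy' : y ≤ l ⊔ m) : x ⊔ y = l ⊔ m := by
  have := hC.finiteDimensional_dLine hl
  have := hC.finiteDimensional_dLine hm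
  exact Submodule.eq_of_le_of_finrank_eq (sup_le hx' hy')
    (by rw [hC.finrank_sup hl hm hlm, hC.finrank_sup hx hy hxy])

theorem ne_of_moves (h : Moves G l m) : l ≠ m := by
  rintro rfl
  obtain ⟨t, ht, hm⟩ := h
  exact hm ht.2.2

/-- A full pair: each axial element fixes some `D`-line of the span. -/
theorem exists_le_fixSpace (hC : IsLineConfiguration G D) (hf : IsAxial G k f)
    (hk : k ∈ dLines D) (hl : l ∈ dLines D) (hm : m ∈ dLines D) (hlm : l ≠ m)
    (hfull : IsFull D l m) : ∃ p ∈ dLines D, p ≤ l ⊔ m ∧ p ≤ fixSpace f := by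
  have := hC.finiteDimensional_dLine hk
  have := hC.finiteDimensional_dLine hm
  have := hC.finiteDimensional_dLine hl
  let φ : ↥(l ⊔ m) →ₗ[ZMod 2] k := LinearMap.codRestrict k
    (((f : V →ₗ[ZMod 2] V) - LinearMap.id).comp (l ⊔ m).subtype) (fun v => hf.sub_mem v)
  -- The map `f - 1` sends the four-dimensional span into the two-dimensional `k`, so it kills a
  -- nonzero vector; fullness puts that vector in a `D`-line.
  have hker := LinearMap.ker_ne_bot_of_finrank_lt (f := φ)
    (by rw [hC.finrank_dLine hk, hC.finrank_sup hl hm hlm]; norm_num)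
  obtain ⟨v, hv, h0⟩ := (Submodule.ne_bot_iff _).1 hker
  have hfix : f v = v := sub_eq_zero.1 (congrArg Subtype.val hv : f v - v = 0)
  obtain ⟨p, hp, hple, hvp⟩ := hfull v v.2
  exact ⟨p, hp, hple, hC.le_fixSpace_of_apply_eq hf hk hp hvp (by simpa using h0) hfix⟩

end IsLineConfiguration
-- Transvections on full spans, and symmetry of moving
namespace IsLineConfiguration

variable {V : Type*} [AddCommGroup V] [Module (ZMod 2) V]
  {G : Subgroup (V ≃ₗ[ZMod 2] V)} {D : Set (V ≃ₗ[ZMod 2] V)}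
  {k l m p q x y U : Submodule (ZMod 2) V} {d e f g h t : V ≃ₗ[ZMod 2] V}

theorem not_le_fixSpace (hC : IsLineConfiguration G D) (hd : d ∈ centeredAt D l) :
    ¬ l ≤ fixSpace d := by
  intro h
  obtain ⟨v, hv, h0⟩ := hC.exists_ne_zero (mem_dLines_of_mem hd)
  exact h0 (hC.eq_zero_of_apply_eq hd hv (mem_fixSpace.1 (h hv)))

theorem isAxial_inv (hf : IsAxial G k f) : IsAxial G k f⁻¹ := by
  refine ⟨G.inv_mem hf.mem, fun v => ?_, ?_⟩
  · have := k.neg_mem (hf.sub_mem (f⁻¹ v))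
    rwa [apply_inv_self', neg_sub] at this
  · rw [fixSpace_inv]
    refine hf.fix.imp_right fun h v hv hfix => h v hv ?_
    rw [← mem_fixSpace, fixSpace_inv] at hfix
    exact mem_fixSpace.1 hfix

theorem act_eq_of_isAxial (hC : IsLineConfiguration G D) (hf : IsAxial G k f)
    (hk : k ∈ dLines D) : act f k = k := by
  refine hC.eq_of_le (hC.act_mem_dLines hf.mem hk) hk ?_
  simpa using act_le_sup (m := k) hf.sub_mem

theorem act_ne_of_isAxial (hC : IsLineConfiguration G D) (hf : IsAxial G k f)
    (hk : k ∈ dLines D) (hm : m ∈ dLines D) (hfm : ¬ m ≤ fixSpace f) (hkm : k ≠ m) :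
    act f m ≠ m := by
  intro h
  exact hkm (hC.eq_of_le hk hm (hC.le_of_le_of_act_le hf hk hm hfm le_rfl h.le))

/-- The span of `l` and `m` is covered by five subspaces if a reflection at `l` moves `m`. -/
theorem mem_or_mem_or_apply_eq (hC : IsLineConfiguration G D) (hd : d ∈ centeredAt D l)
    (hm : m ∈ dLines D) (hdm : ¬ m ≤ fixSpace d) {w : V} (hw : w ∈ l ⊔ m) :
    w ∈ l ∨ w ∈ m ∨ w ∈ act d m ∨ w ∈ act d (act d m) ∨ d w = w := by
  obtain ⟨a, ha, b, hb, rfl⟩ := Submodule.mem_sup.1 hw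
  by_cases hb0 : b = 0
  · left; simpa [hb0] using ha
  by_cases ha0 : a = 0
  · right; left; simpa [ha0] using hb
  have hl := mem_dLines_of_mem hd
  have hx0 : d b - b ≠ 0 :=
    sub_ne_zero.2 (hC.apply_ne (hC.isAxial_of_centeredAt hd) hl hm hdm hb hb0)
  obtain ⟨x, hx⟩ : ∃ x, x = d b - b := ⟨_, rfl⟩
  have hxl : x ∈ l := hx ▸ sub_mem_of_mem hd b
  have hdb : d b = x + b := by rw [hx]; abel
  have hdx := hC.apply_apply_eq hd hxl
  have hxx := ZModModule.add_self x
  -- With `x = d b - b`, the nonzero vectors of `l` are `x`, `d x` and `d² x`. Adding them to `b`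
  -- gives `d b`, a fixed vector of `d`, and `d² b` respectively.
  rcases hC.eq_or_eq_apply hd hxl ha (hx ▸ hx0) ha0 with h | h | h
  · right; right; left
    rw [h, ← hdb]
    exact apply_mem_act hb
  · right; right; right; right
    rw [h, map_add, hdx, hdb]
    linear_combination (norm := module) hxx
  · right; right; right; left
    have : a + b = d (d b) := by
      rw [hdb, map_add, hdb, h, hdx]
      abel
    rw [this]
    exact apply_mem_act (apply_mem_act hb)

/-- Transvections with center `l` form a space over the field generated by a reflection. -/
theorem exists_transvection_smul (hC : IsLineConfiguration G D) (hd : d ∈ centeredAt D l)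
    (ht : t ∈ transvections G l) :
    ∃ s ∈ transvections G l, ∀ v, s v - v = d (t v - v) := by
  have hl := mem_dLines_of_mem hd
  have h := conj_mem_transvections (hC.mem_group hd) ht
  rw [hC.act_eq_of_isAxial (hC.isAxial_of_centeredAt hd) hl] at h
  refine ⟨_, h, fun v => ?_⟩
  change d (t (d⁻¹ v)) - v = _
  have hc : d⁻¹ v - v ∈ l := (isAxial_inv (hC.isAxial_of_centeredAt hd)).sub_mem v
  have h1 : t (d⁻¹ v) = d⁻¹ v + (t v - v) := by
    have := mem_fixSpace.1 (ht.2.2 hc)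
    rw [map_sub] at this
    linear_combination (norm := module) this
  rw [h1, map_add, apply_inv_self']
  abel

theorem one_mem_transvections : (1 : V ≃ₗ[ZMod 2] V) ∈ transvections G l :=
  ⟨G.one_mem, fun v => by simp, fun v _ => mem_fixSpace.2 rfl⟩

/-- Conjugating `t` by a reflection `d` at `l` applies `d` to the displacement `t b - b`, and the
powers of `d` carry one nonzero vector of `l` to all of them. The new transvections still fix
whatever `t` fixes. -/
theorem exists_transvection_apply (hC : IsLineConfiguration G D) (hl : l ∈ dLines D)
    (ht : t ∈ transvections G l) (hm : m ∈ dLines D) (htm : ¬ m ≤ fixSpace t) {a b : V}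
    (ha : a ∈ l) (hb : b ∈ m) (hb0 : b ≠ 0) :
    ∃ s ∈ transvections G l, s b = a + b ∧ fixSpace t ≤ fixSpace s := by
  by_cases ha0 : a = 0
  · exact ⟨1, one_mem_transvections, by simp [ha0], fun v _ => mem_fixSpace.2 rfl⟩
  obtain ⟨d, hd⟩ := exists_mem_centeredAt hl
  have hx0 : t b - b ≠ 0 :=
    sub_ne_zero.2 (hC.apply_ne (isAxial_of_transvections ht) hl hm htm hb hb0)
  obtain ⟨s, hs, hsv⟩ := hC.exists_transvection_smul hd ht
  obtain ⟨r, hr, hrv⟩ := hC.exists_transvection_smul hd hs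
  rcases hC.eq_or_eq_apply hd (ht.2.1 b) ha hx0 ha0 with h | h | h
  · exact ⟨t, ht, by rw [h]; abel, le_rfl⟩
  · refine ⟨s, hs, by rw [h, ← hsv]; abel, fun v hv => ?_⟩
    rw [mem_fixSpace] at hv ⊢
    have := hsv v
    rwa [hv, sub_self, map_zero, sub_eq_zero] at this
  · refine ⟨r, hr, by rw [h, ← hsv, ← hrv]; abel, fun v hv => ?_⟩
    rw [mem_fixSpace] at hv ⊢
    have := hrv v
    rwa [hsv, hv, sub_self, map_zero, map_zero, sub_eq_zero] at this

theorem exists_transvection_act (hC : IsLineConfiguration G D) (hl : l ∈ dLines D)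
    (ht : t ∈ transvections G l) (hm : m ∈ dLines D) (htm : ¬ m ≤ fixSpace t)
    (hp : p ∈ dLines D) (hpl : p ≤ l ⊔ m) (hne : p ≠ l) :
    ∃ s ∈ transvections G l, act s m = p ∧ fixSpace t ≤ fixSpace s := by
  obtain ⟨v, hv, h0⟩ := hC.exists_ne_zero hp
  obtain ⟨a, ha, b, hb, rfl⟩ := Submodule.mem_sup.1 (hpl hv)
  have hb0 : b ≠ 0 := by
    rintro rfl
    exact hne (hC.eq_of_mem_of_mem hp hl h0 hv (by simpa using ha))
  obtain ⟨s, hs, hsb, hfix⟩ := hC.exists_transvection_apply hl ht hm htm ha hb hb0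
  refine ⟨s, hs, ?_, hfix⟩
  exact hC.eq_of_mem_of_mem (hC.act_mem_dLines hs.1 hm) hp h0 (hsb ▸ apply_mem_act hb) hv

theorem isFull_of_moves (hC : IsLineConfiguration G D) (hl : l ∈ dLines D) (hm : m ∈ dLines D)
    (h : Moves G l m) : IsFull D l m := by
  obtain ⟨t, ht, htm⟩ := h
  intro v hv
  obtain ⟨a, ha, b, hb, rfl⟩ := Submodule.mem_sup.1 hv
  by_cases hb0 : b = 0
  · exact ⟨l, hl, le_sup_left, by simpa [hb0] using ha⟩
  obtain ⟨s, hs, hsb, -⟩ := hC.exists_transvection_apply hl ht hm htm ha hb hb0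
  exact ⟨act s m, hC.act_mem_dLines hs.1 hm, act_le_sup hs.2.1, hsb ▸ apply_mem_act hb⟩

/-- A transvection at `l` fixing also `p` would fix `l ⊔ p = l ⊔ m`. -/
theorem moves_of_le (hC : IsLineConfiguration G D) (hl : l ∈ dLines D) (hm : m ∈ dLines D)
    (h : Moves G l m) (hp : p ∈ dLines D) (hpl : p ≤ l ⊔ m) (hne : p ≠ l) : Moves G l p := by
  have hlm := ne_of_moves h
  obtain ⟨t, ht, htm⟩ := h
  refine ⟨t, ht, fun hpt => htm ?_⟩
  have := hC.sup_eq_sup hl hm hl hp hlm hne.symm le_sup_left hpl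
  exact le_sup_right.trans (this ▸ sup_le ht.2.2 hpt)

/-- Conjugation spreads the property of moving from `l` to other lines of the span. As `l` moves
`d⁻¹ l`, applying `d` shows that `d l` moves `l`. So some transvection `s` at `d l` takes `l` to
`m`, and applying `s` to the fact that `l` moves `s⁻¹ l` gives the claim. -/
theorem moves_of_moves_of_centeredAt (hC : IsLineConfiguration G D) (hl : l ∈ dLines D)
    (h : Moves G l m) (hd : d ∈ centeredAt D m) (hdl : ¬ l ≤ fixSpace d) : Moves G m l := by
  have hm := mem_dLines_of_mem hd
  have hax := hC.isAxial_of_centeredAt hd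
  have hG := hC.mem_group hd
  have hlm := ne_of_moves h
  have hdlL := hC.act_mem_dLines hG hl
  have hdl_ne : act d l ≠ l := hC.act_ne_of_isAxial hax hm hl hdl hlm.symm
  have hdm_ne : act d l ≠ m := by
    intro heq
    rw [← hC.act_eq_of_isAxial hax hm] at heq
    exact hlm (act_injective d heq)
  have hdl_le : act d l ≤ l ⊔ m := by rw [sup_comm]; exact act_le_sup hax.sub_mem
  have h1 : Moves G (act d l) l := by
    have h2 : Moves G l (act d⁻¹ l) := by
      refine hC.moves_of_le hl hm h (hC.act_mem_dLines (G.inv_mem hG) hl) ?_ ?_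
      · rw [sup_comm]; exact act_le_sup (isAxial_inv hax).sub_mem
      · exact hC.act_ne_of_isAxial (isAxial_inv hax) hm hl (by rwa [fixSpace_inv]) hlm.symm
    have := moves_act hG h2
    rwa [act_act_inv] at this
  obtain ⟨t, ht, htl⟩ := h1
  have hsup := hC.sup_eq_sup hl hm hdlL hl hlm hdl_ne hdl_le le_sup_left
  obtain ⟨s, hs, hsl, -⟩ := hC.exists_transvection_act hdlL ht hl htl hm
    (hsup ▸ le_sup_right) hdm_ne.symm
  have h3 : Moves G l (act s⁻¹ l) := by
    refine hC.moves_of_le hl hm h (hC.act_mem_dLines (G.inv_mem hs.1) hl) ?_ ?_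
    · rw [← hsup]; exact act_le_sup (isAxial_inv (isAxial_of_transvections hs)).sub_mem
    · intro heq
      apply hlm
      rw [← hsl, ← heq, act_act_inv, heq]
  have := moves_act hs.1 h3
  rwa [act_act_inv, hsl] at this

theorem le_fixSpace_act (hC : IsLineConfiguration G D) (hg : g ∈ G)
    (h : ∀ d ∈ centeredAt D m, U ≤ fixSpace d) :
    ∀ d ∈ centeredAt D (act g m), act g U ≤ fixSpace d := by
  intro d hd
  have h1 := hC.conj_mem_centeredAt (G.inv_mem hg) hd
  rw [act_inv_act] at h1
  have h2 := h _ h1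
  rw [fixSpace_conj] at h2
  have := act_mono g h2
  rwa [act_act_inv] at this

/-- If all reflections at `m` fixed `l`, they would also fix `t l` for a transvection `t` at `m`
moving `l`. The differences `t v - v` with `v ∈ l` fill `m`, so these reflections would fix their
own center. -/
theorem exists_centeredAt_of_moves (hC : IsLineConfiguration G D) (hl : l ∈ dLines D)
    (hm : m ∈ dLines D) (h : Moves G m l) : ∃ d ∈ centeredAt D m, ¬ l ≤ fixSpace d := by
  by_contra! hcon
  obtain ⟨t, ht, htl⟩ := h
  have hax := isAxial_of_transvections ht
  obtain ⟨d, hd⟩ := exists_mem_centeredAt hm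
  have h1 := hC.le_fixSpace_act ht.1 hcon d (by rwa [hC.act_eq_of_isAxial hax hm])
  exact hC.not_le_fixSpace hd (hC.le_of_le_of_act_le hax hm hl htl (hcon d hd) h1)

/-- Transvections at `l` move `m`, but reflections at `m` fix `l`. -/
def Dominates (G : Subgroup (V ≃ₗ[ZMod 2] V)) (D : Set (V ≃ₗ[ZMod 2] V))
    (l m : Submodule (ZMod 2) V) : Prop :=
  Moves G l m ∧ ∀ d ∈ centeredAt D m, l ≤ fixSpace d

theorem not_moves_of_fix (hC : IsLineConfiguration G D) (hl : l ∈ dLines D)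
    (hm : m ∈ dLines D) (h : ∀ d ∈ centeredAt D m, l ≤ fixSpace d) : ¬ Moves G m l := by
  intro h1
  obtain ⟨d, hd, hdl⟩ := hC.exists_centeredAt_of_moves hl hm h1
  exact hdl (h d hd)

theorem dominates_of_le (hC : IsLineConfiguration G D) (hl : l ∈ dLines D)
    (hm : m ∈ dLines D) (h : Dominates G D l m) (hp : p ∈ dLines D) (hpl : p ≤ l ⊔ m)
    (hne : p ≠ l) : Dominates G D l p := by
  refine ⟨hC.moves_of_le hl hm h.1 hp hpl hne, ?_⟩
  obtain ⟨t, ht, htm⟩ := h.1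
  obtain ⟨s, hs, rfl, -⟩ := hC.exists_transvection_act hl ht hm htm hp hpl hne
  have := hC.le_fixSpace_act hs.1 h.2
  rwa [act_eq_self hs.2.2] at this

/-- Reflections at `m` fix every `D`-line `k` that is moved by transvections at `l`, and at which
there is a reflection moving `l`. -/
theorem fix_of_dominates (hC : IsLineConfiguration G D) (hl : l ∈ dLines D)
    (hm : m ∈ dLines D) (hk : k ∈ dLines D) (h : Dominates G D l m) (hlk : Moves G l k)
    (hkl : Moves G k l) : ∀ d ∈ centeredAt D m, k ≤ fixSpace d := by
  -- Conjugation by `t` permutes the reflections at `j`, so they fix `t l` as well as `l`, and hence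
  -- the center `k` of `t`.
  have key : ∀ j ∈ dLines D, Dominates G D l j → ∀ t ∈ transvections G k, ¬ l ≤ fixSpace t →
      j ≤ fixSpace t → ∀ d ∈ centeredAt D j, k ≤ fixSpace d := by
    intro j hj hlj t ht htl htj d hd
    have h1 := hC.le_fixSpace_act ht.1 hlj.2
    rw [act_eq_self htj] at h1
    exact hC.le_of_le_of_act_le (isAxial_of_transvections ht) hk hl htl (hlj.2 d hd) (h1 d hd)
  by_contra! hcon
  obtain ⟨d, hd, hdk⟩ := hcon
  have hlm := ne_of_moves h.1
  obtain ⟨t₀, ht₀, ht₀l⟩ := hkl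
  have ht₀m : ¬ m ≤ fixSpace t₀ := fun hle => hdk (key m hm h t₀ ht₀ ht₀l hle d hd)
  have hkm : Moves G k m := ⟨t₀, ht₀, ht₀m⟩
  have hmk : Moves G m k := hC.moves_of_moves_of_centeredAt hk hkm hd hdk
  have hml : ¬ Moves G m l := hC.not_moves_of_fix hl hm h.2
  have hfixl : ∀ t ∈ transvections G m, l ≤ fixSpace t := by
    intro t ht
    by_contra hc
    exact hml ⟨t, ht, hc⟩
  -- A line `j` of the span fixed by `t₀` satisfies the claim by `key`. The aim is to carry this
  -- from `j` back to `m` by an element of `G` fixing `k`.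
  obtain ⟨j, hj, hjle, hjt⟩ := hC.exists_le_fixSpace (isAxial_of_transvections ht₀) hk hl hm hlm
    (hC.isFull_of_moves hl hm h.1)
  have hjl : j ≠ l := by rintro rfl; exact ht₀l hjt
  have hDj := key j hj (hC.dominates_of_le hl hm h hj hjle hjl) t₀ ht₀ ht₀l hjt
  obtain ⟨t, ht, htm⟩ := h.1
  obtain ⟨t₁, ht₁, ht₁m, -⟩ := hC.exists_transvection_act hl ht hm htm hj hjle hjl
  -- some transvection at `l` fixes `k` and maps `m` to `j`
  obtain ⟨s, hs, hsk, hsm⟩ : ∃ s ∈ G, k ≤ fixSpace s ∧ act s m = j := by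
    obtain ⟨u, hu, hule, hut⟩ := hC.exists_le_fixSpace (isAxial_of_transvections ht₁) hl hm hk
      (ne_of_moves hmk) (hC.isFull_of_moves hm hk hmk)
    have hum : u ≠ m := by
      rintro rfl
      rw [act_eq_self hut] at ht₁m
      subst ht₁m
      exact hdk (hDj d hd)
    -- Let `r` at `m` take `k` to the line `u` fixed by `t₁`. As `r` is trivial on `l ⊔ m`, the
    -- conjugate `r⁻¹ t₁ r` still maps `m` to `j`, but now fixes `k`.
    obtain ⟨r, hr, hrk⟩ := hmk
    obtain ⟨r, hr, hru, -⟩ := hC.exists_transvection_act hm hr hk hrk hu hule hum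
    have hrl := hfixl r hr
    refine ⟨r⁻¹ * t₁ * r⁻¹⁻¹, G.mul_mem (G.mul_mem (G.inv_mem hr.1) ht₁.1)
      (G.inv_mem (G.inv_mem hr.1)), ?_, ?_⟩
    · rw [fixSpace_conj, ← act_inv_act r k, act_le_iff, hru]
      exact hut
    · have hrX : l ⊔ m ≤ fixSpace r := sup_le hrl hr.2.2
      rw [act_mul, act_mul, inv_inv, act_eq_self hr.2.2, ht₁m]
      exact act_eq_self (by rw [fixSpace_inv]; exact hjle.trans hrX)
  have := hC.le_fixSpace_act (G.inv_mem hs) hDj d (by rwa [← hsm, act_inv_act])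
  rw [act_eq_self (by rwa [fixSpace_inv])] at this
  exact hdk this

/-- Domination of `m` passes from `l` to `f l`, since `f l ≤ l ⊔ k` and both `l` and `k` are fixed
by the reflections at `m`. Moreover `f l` moves the line `m₀` of `l ⊔ m` fixed by `f`, and a
transvection at `l` that fixes `k`, hence `f l`, takes `m₀` to `m`. -/
theorem dominates_act (hC : IsLineConfiguration G D) (hl : l ∈ dLines D) (hm : m ∈ dLines D)
    (h : Dominates G D l m) (hf : f ∈ centeredAt D k) : Dominates G D (act f l) m := by
  have hk := mem_dLines_of_mem hf
  have hax := hC.isAxial_of_centeredAt hf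
  by_cases hfl : l ≤ fixSpace f
  · rwa [act_eq_self hfl]
  by_cases hkl : k = l
  · subst hkl
    rwa [hC.act_eq_of_isAxial hax hk]
  have hlm := ne_of_moves h.1
  have hfl_le : act f l ≤ l ⊔ k := by rw [sup_comm]; exact act_le_sup hax.sub_mem
  obtain ⟨m₀, hm₀, hm₀le, hm₀f⟩ := hC.exists_le_fixSpace hax hk hl hm hlm
    (hC.isFull_of_moves hl hm h.1)
  have hm₀l : m₀ ≠ l := by rintro rfl; exact hfl hm₀f
  have hdom₀ := hC.dominates_of_le hl hm h hm₀ hm₀le hm₀l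
  have hsup := hC.sup_eq_sup hl hm hl hm₀ hlm hm₀l.symm le_sup_left hm₀le
  -- reflections at `m` fix `k`, and a transvection at `l` moving `m` fixes `k`
  have main : (∀ d ∈ centeredAt D m, k ≤ fixSpace d) ∧
      ∃ t ∈ transvections G l, k ≤ fixSpace t ∧ ¬ m ≤ fixSpace t := by
    by_cases hlk : Moves G l k
    · have hfix := hC.fix_of_dominates hl hm hk h hlk
        (hC.moves_of_moves_of_centeredAt hl hlk hf hfl)
      refine ⟨hfix, ?_⟩
      obtain ⟨d, hd⟩ := exists_mem_centeredAt hm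
      obtain ⟨t, ht, htm⟩ := h.1
      have hdl := h.2 d hd
      have hdG := hC.mem_group hd
      have ht' : d * t * d⁻¹ ∈ transvections G l := by
        have := conj_mem_transvections hdG ht
        rwa [act_eq_self hdl] at this
      have key : ∀ v, (d * t * d⁻¹ * t⁻¹) v = d (t (d⁻¹ (t⁻¹ v))) := fun v => rfl
      have hinv : ∀ v, t⁻¹ v - v ∈ l := (isAxial_inv (isAxial_of_transvections ht)).sub_mem
      have hdinv : ∀ v ∈ l, d⁻¹ v = v := fun v hv =>
        mem_fixSpace.1 (fixSpace_inv d ▸ hdl hv)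
      -- The commutator of `d` and `t` fixes `k` because `d` fixes both `k` and `l`. It is
      -- nontrivial on `m`: otherwise `t` would fix the nonzero vector `d⁻¹ v - v` of `m`.
      refine ⟨d * t * d⁻¹ * t⁻¹, ⟨G.mul_mem ht'.1 (G.inv_mem ht.1), fun v => ?_, ?_⟩, ?_, ?_⟩
      · have := l.add_mem (ht'.2.1 (t⁻¹ v)) (hinv v)
        rwa [sub_add_sub_cancel] at this
      · intro v hv
        rw [mem_fixSpace]
        have h1 : t⁻¹ v = v := mem_fixSpace.1 (fixSpace_inv t ▸ ht.2.2 hv)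
        change (d * t * d⁻¹) (t⁻¹ v) = v
        rw [h1]
        exact mem_fixSpace.1 (ht'.2.2 hv)
      · intro v hv
        rw [mem_fixSpace, key]
        have h1 : d⁻¹ (t⁻¹ v) = t⁻¹ v := by
          have h2 := hdinv _ (hinv v)
          have h3 : d⁻¹ v = v := mem_fixSpace.1 (fixSpace_inv d ▸ hfix d hd hv)
          rw [map_sub, h3] at h2
          linear_combination (norm := module) h2
        rw [h1, apply_inv_self']
        exact mem_fixSpace.1 (hfix d hd hv)
      · intro hle
        obtain ⟨v, hv, h0⟩ := hC.exists_ne_zero hm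
        -- `t` and its conjugate agree on `m`
        have h1 : ∀ w ∈ m, t (d⁻¹ w - w) = d⁻¹ w - w := by
          intro w hw
          have h2 : d (t (d⁻¹ w)) = t w := by
            have hm' : t w ∈ fixSpace (d * t * d⁻¹ * t⁻¹) := by
              have h4 : l ⊔ m ≤ fixSpace (d * t * d⁻¹ * t⁻¹) := by
                refine sup_le ?_ hle
                intro z hz
                rw [mem_fixSpace]
                have h1 : t⁻¹ z = z := mem_fixSpace.1 (fixSpace_inv t ▸ ht.2.2 hz)
                change (d * t * d⁻¹) (t⁻¹ z) = z
                rw [h1]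
                exact mem_fixSpace.1 (ht'.2.2 hz)
              exact h4 (act_le_sup ht.2.1 (apply_mem_act hw))
            have := mem_fixSpace.1 hm'
            rwa [key, inv_apply_self'] at this
          have h3 : d (t (d⁻¹ w) - d⁻¹ w) = t (d⁻¹ w) - d⁻¹ w :=
            mem_fixSpace.1 (hdl (ht.2.1 _))
          rw [map_sub, apply_inv_self', h2] at h3
          rw [map_sub]
          linear_combination (norm := module) - h3
        have h2 : d⁻¹ v - v ∈ m := (isAxial_inv (hC.isAxial_of_centeredAt hd)).sub_mem v
        refine htm (hC.le_fixSpace_of_apply_eq (isAxial_of_transvections ht) hl hm h2 ?_ (h1 v hv))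
        intro h3
        refine h0 (hC.eq_zero_of_apply_eq hd hv ?_)
        rw [sub_eq_zero] at h3
        nth_rw 1 [← h3]
        exact apply_inv_self' d v
    · have hfixk : ∀ t ∈ transvections G l, k ≤ fixSpace t := by
        intro t ht
        by_contra hc
        exact hlk ⟨t, ht, hc⟩
      obtain ⟨t, ht, htm⟩ := h.1
      refine ⟨fun d hd => ?_, t, ht, hfixk t ht, htm⟩
      by_contra hdk
      have hdl := h.2 d hd
      have hdG := hC.mem_group hd
      have h1 : act d⁻¹ k ≤ fixSpace t := by
        have h2 := conj_mem_transvections hdG ht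
        rw [act_eq_self hdl] at h2
        have h3 := hfixk _ h2
        rw [fixSpace_conj] at h3
        have := act_mono d⁻¹ h3
        rwa [act_inv_act] at this
      exact htm (hC.le_of_le_of_act_le (isAxial_inv (hC.isAxial_of_centeredAt hd)) hm hk
        (by rwa [fixSpace_inv]) (hfixk t ht) h1)
  obtain ⟨hfixk, t, ht, htk, htm⟩ := main
  have hfl_fix : ∀ d ∈ centeredAt D m, act f l ≤ fixSpace d := fun d hd =>
    hfl_le.trans (sup_le (h.2 d hd) (hfixk d hd))
  refine ⟨?_, hfl_fix⟩
  have htm₀ : ¬ m₀ ≤ fixSpace t := fun hle =>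
    htm (le_sup_right.trans (hsup ▸ sup_le ht.2.2 hle))
  obtain ⟨s, hs, hsm, hsfix⟩ := hC.exists_transvection_act hl ht hm₀ htm₀ hm
    (hsup ▸ le_sup_right) hlm.symm
  have h1 := moves_act hax.mem hdom₀.1
  rw [act_eq_self hm₀f] at h1
  have h2 := moves_act hs.1 h1
  rwa [hsm, act_eq_self (hfl_le.trans (sup_le hs.2.2 (htk.trans hsfix)))] at h2

/-- The group is transitive on the `D`-lines. -/
def IsTransitive (G : Subgroup (V ≃ₗ[ZMod 2] V)) (D : Set (V ≃ₗ[ZMod 2] V)) : Prop :=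
  ∀ l ∈ dLines D, ∀ m ∈ dLines D, ∃ g ∈ G, act g l = m

/-- The lines dominating a fixed `m` form a `G`-invariant set. By transitivity `m` would dominate
itself, but transvections fix their center. -/
theorem not_dominates (hC : IsLineConfiguration G D) (htr : IsTransitive G D)
    (hl : l ∈ dLines D) (hm : m ∈ dLines D) : ¬ Dominates G D l m := by
  intro h
  have key : ∀ g ∈ Subgroup.closure D, ∀ p ∈ dLines D,
      (Dominates G D p m → Dominates G D (act g p) m) ∧
      (Dominates G D p m → Dominates G D (act g⁻¹ p) m) := by
    intro g hg
    induction hg using Subgroup.closure_induction with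
    | mem d hd =>
      intro p hp
      have hd' : d ∈ centeredAt D (commSpace d) := ⟨hd, rfl⟩
      refine ⟨fun h => hC.dominates_act hp hm h hd', fun h => ?_⟩
      have hinv : d⁻¹ = d * d := by
        ext v
        rw [← hC.cube_apply hd' v, inv_apply_self', hC.cube_apply hd']
        rfl
      rw [hinv, act_mul]
      exact hC.dominates_act (hC.act_mem_dLines (hC.mem_of_mem hd) hp) hm
        (hC.dominates_act hp hm h hd') hd'
    | one =>
      intro p hp
      rw [inv_one, act_eq_self fun v _ => mem_fixSpace.2 rfl]
      exact ⟨id, id⟩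
    | mul a b ha hb iha ihb =>
      intro p hp
      rw [hC.closure_eq] at ha hb
      rw [mul_inv_rev, act_mul, act_mul]
      exact ⟨fun h => (iha _ (hC.act_mem_dLines hb hp)).1 ((ihb p hp).1 h),
        fun h => (ihb _ (hC.act_mem_dLines (G.inv_mem ha) hp)).2 ((iha p hp).2 h)⟩
    | inv a ha ih =>
      intro p hp
      rw [inv_inv]
      exact (ih p hp).symm
  obtain ⟨g, hg, hgl⟩ := htr l hl m hm
  have := (key g (by rwa [hC.closure_eq]) l hl).1 h
  rw [hgl] at this
  exact ne_of_moves this.1 rfl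

theorem moves_symm (hC : IsLineConfiguration G D) (htr : IsTransitive G D)
    (hl : l ∈ dLines D) (hm : m ∈ dLines D) (h : Moves G l m) : Moves G m l := by
  by_contra hcon
  refine hC.not_dominates htr hl hm ⟨h, fun d hd => ?_⟩
  by_contra hdl
  exact hcon (hC.moves_of_moves_of_centeredAt hl h hd hdl)

end IsLineConfiguration
-- Full spans, commuting reflections and transitivity of moving
namespace IsLineConfiguration

variable {V : Type*} [AddCommGroup V] [Module (ZMod 2) V]
  {G : Subgroup (V ≃ₗ[ZMod 2] V)} {D : Set (V ≃ₗ[ZMod 2] V)}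
  {k l m p q x y U : Submodule (ZMod 2) V} {d e f g h t : V ≃ₗ[ZMod 2] V}

theorem sup_le_of_le (hC : IsLineConfiguration G D) (hl : l ∈ dLines D) (hm : m ∈ dLines D)
    (hx : x ∈ dLines D) (hy : y ∈ dLines D) (hlm : l ≠ m) (hxy : x ≠ y) (hx' : x ≤ l ⊔ m)
    (hy' : y ≤ l ⊔ m) (hxU : x ≤ U) (hyU : y ≤ U) : l ⊔ m ≤ U :=
  hC.sup_eq_sup hl hm hx hy hlm hxy hx' hy' ▸ sup_le hxU hyU

theorem isFull_congr (hC : IsLineConfiguration G D) (hl : l ∈ dLines D) (hm : m ∈ dLines D)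
    (hx : x ∈ dLines D) (hy : y ∈ dLines D) (hlm : l ≠ m) (hxy : x ≠ y) (hx' : x ≤ l ⊔ m)
    (hy' : y ≤ l ⊔ m) (h : IsFull D x y) : IsFull D l m := by
  unfold IsFull at h ⊢
  rwa [← hC.sup_eq_sup hl hm hx hy hlm hxy hx' hy']

theorem act_cube (hC : IsLineConfiguration G D) (hd : d ∈ centeredAt D l) :
    act d (act d (act d m)) = m := by
  ext v
  have : d⁻¹ (d⁻¹ (d⁻¹ v)) = v := by
    nth_rw 1 [← hC.cube_apply hd v]
    simp only [inv_apply_self']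
  rw [mem_act, mem_act, mem_act, this]

/-- The conjugate of `e` by `d` is again centered at `y` and differs from `e` by a transvection at
`y`, which is trivial on the span by hypothesis. So if `e` fixes `z`, it also fixes `d z`. As `e`
cannot fix the whole span, `d z = z`; since `d` cannot fix both `y` and `z`, this leaves `z = x`. -/
theorem le_fixSpace_of_fix (hC : IsLineConfiguration G D) (hl : l ∈ dLines D)
    (hm : m ∈ dLines D) (hlm : l ≠ m) (hfull : IsFull D l m)
    (hno : ∀ x ∈ dLines D, ∀ y ∈ dLines D, x ≤ l ⊔ m → y ≤ l ⊔ m → ¬ Moves G x y)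
    (hx : x ≤ l ⊔ m) (hy : y ≤ l ⊔ m) (hd : d ∈ centeredAt D x)
    (hdy : y ≤ fixSpace d) (he : e ∈ centeredAt D y) : x ≤ fixSpace e := by
  have hxL := mem_dLines_of_mem hd
  have hyL := mem_dLines_of_mem he
  have hdG := hC.mem_group hd
  have hdax := hC.isAxial_of_centeredAt hd
  have heax := hC.isAxial_of_centeredAt he
  obtain ⟨z, hz, hzle, hze⟩ := hC.exists_le_fixSpace heax hyL hl hm hlm hfull
  have hzy : z ≠ y := by rintro rfl; exact hC.not_le_fixSpace he hze
  have he' := hC.conj_mem_centeredAt hdG he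
  rw [act_eq_self hdy] at he'
  -- the conjugate of `e` by `d` agrees with `e` on the span
  have hT : e⁻¹ * (d * e * d⁻¹) ∈ transvections G y := by
    refine ⟨G.mul_mem (G.inv_mem heax.mem) (hC.mem_group he'), fun v => ?_, fun v hv => ?_⟩
    · have h1 := (isAxial_inv heax).sub_mem ((d * e * d⁻¹) v)
      have := y.add_mem h1 (sub_mem_of_mem he' v)
      rwa [sub_add_sub_cancel] at this
    · rw [mem_fixSpace]
      change e⁻¹ (d (e (d⁻¹ v))) = v
      have h1 : d⁻¹ v = v := mem_fixSpace.1 (fixSpace_inv d ▸ hdy hv)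
      rw [h1, mem_fixSpace.1 (hdy (apply_mem he hv)), inv_apply_self']
  have hagree : ∀ v ∈ l ⊔ m, (d * e * d⁻¹) v = e v := by
    intro v hv
    have hle : l ⊔ m ≤ fixSpace (e⁻¹ * (d * e * d⁻¹)) := by
      refine sup_le ?_ ?_
      · by_contra hc
        exact hno y hyL l hl hy le_sup_left ⟨_, hT, hc⟩
      · by_contra hc
        exact hno y hyL m hm hy le_sup_right ⟨_, hT, hc⟩
    have h1 : e⁻¹ ((d * e * d⁻¹) v) = v := mem_fixSpace.1 (hle hv)
    nth_rw 2 [← h1]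
    exact (apply_inv_self' e _).symm
  have hxz : x ⊔ z ≤ l ⊔ m := sup_le hx hzle
  have hdz : act d z ≤ l ⊔ m := (act_le_sup hdax.sub_mem).trans hxz
  have hdze : act d z ≤ fixSpace e := by
    intro v hv
    rw [mem_fixSpace, ← hagree v (hdz hv), ← mem_fixSpace, fixSpace_conj]
    exact act_mono d hze hv
  by_cases heq : act d z = z
  · by_cases hzx : z = x
    · rwa [← hzx]
    have hzd : z ≤ fixSpace d := by
      by_contra hc
      exact hC.act_ne_of_isAxial hdax hxL hz hc (Ne.symm hzx) heq
    exact absurd (hx.trans (hC.sup_le_of_le hl hm hz hyL hlm hzy hzle hy hzd hdy))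
      (hC.not_le_fixSpace hd)
  · exact absurd (hy.trans (hC.sup_le_of_le hl hm (hC.act_mem_dLines hdG hz) hz hlm heq hdz hzle
      hdze hze)) (hC.not_le_fixSpace he)

/-- A parity argument: without a moving pair, commuting would be symmetric and each reflection in
the span would fix exactly one of its five `D`-lines, pairing off an odd number of lines.
Concretely, the partner `w` of `y` would be `d y` or `d⁻¹ y`, and conjugation by `d` or `d⁻¹` gives
`w` a second partner. -/
theorem exists_moves_of_isFull (hC : IsLineConfiguration G D) (hl : l ∈ dLines D)
    (hm : m ∈ dLines D) (hlm : l ≠ m) (hfull : IsFull D l m) :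
    ∃ x ∈ dLines D, ∃ y ∈ dLines D, x ≤ l ⊔ m ∧ y ≤ l ⊔ m ∧ Moves G x y := by
  by_contra! hno
  have key : ∀ {x y : Submodule (ZMod 2) V} {d e : V ≃ₗ[ZMod 2] V}, x ≤ l ⊔ m → y ≤ l ⊔ m →
      d ∈ centeredAt D x → y ≤ fixSpace d → e ∈ centeredAt D y → x ≤ fixSpace e :=
    fun hx hy hd hdy he => hC.le_fixSpace_of_fix hl hm hlm hfull hno hx hy hd hdy he
  have contra : ∀ {x y z : Submodule (ZMod 2) V} {d : V ≃ₗ[ZMod 2] V}, d ∈ centeredAt D z →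
      z ≤ l ⊔ m → x ∈ dLines D → y ∈ dLines D → x ≤ l ⊔ m → y ≤ l ⊔ m → x ≠ y →
      x ≤ fixSpace d → y ≤ fixSpace d → False :=
    fun hd hz hx hy hxle hyle hxy hxd hyd => hC.not_le_fixSpace hd
      (hz.trans (hC.sup_le_of_le hl hm hx hy hlm hxy hxle hyle hxd hyd))
  obtain ⟨d, hd⟩ := exists_mem_centeredAt hl
  have hdax := hC.isAxial_of_centeredAt hd
  have hdG := hC.mem_group hd
  obtain ⟨z, hz, hzle, hzd⟩ := hC.exists_le_fixSpace hdax hl hl hm hlm hfull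
  have hzl : z ≠ l := by rintro rfl; exact hC.not_le_fixSpace hd hzd
  obtain ⟨a, ha, ha0⟩ := hC.exists_ne_zero hl
  obtain ⟨b, hb, hb0⟩ := hC.exists_ne_zero hz
  obtain ⟨y, hy, hyle, hyab⟩ := hfull (a + b) (add_mem (Submodule.mem_sup_left ha) (hzle hb))
  have hyl : y ≠ l := by
    rintro rfl
    exact hzl (hC.eq_of_mem_of_mem hz hl hb0 hb (by simpa using sub_mem hyab ha))
  have hyz : y ≠ z := by
    rintro rfl
    exact hzl (hC.eq_of_mem_of_mem hz hl ha0 (by simpa using sub_mem hyab hb) ha)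
  have hyd : ¬ y ≤ fixSpace d := fun h => contra hd le_sup_left hy hz hyle hzle hyz h hzd
  obtain ⟨g, hg⟩ := exists_mem_centeredAt hy
  obtain ⟨w, hw, hwle, hwg⟩ :=
    hC.exists_le_fixSpace (hC.isAxial_of_centeredAt hg) hy hl hm hlm hfull
  have hwy : w ≠ y := by rintro rfl; exact hC.not_le_fixSpace hg hwg
  have hfixy : ∀ e ∈ centeredAt D w, y ≤ fixSpace e := fun e he => key hyle hwle hg hwg he
  have hwl : w ≠ l := by rintro rfl; exact hyd (hfixy d hd)
  have hwz : w ≠ z := by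
    rintro rfl
    obtain ⟨e, he⟩ := exists_mem_centeredAt hz
    exact contra he hzle hl hy le_sup_left hyle hyl.symm (key le_sup_left hzle hd hzd he)
      (hfixy e he)
  have hwd : ¬ w ≤ fixSpace d := fun h => contra hd le_sup_left hw hz hwle hzle hwz h hzd
  have hsup := hC.sup_eq_sup hl hm hl hy hlm hyl.symm le_sup_left hyle
  obtain ⟨u, hu, hu0⟩ := hC.exists_ne_zero hw
  have hdy := hC.act_mem_dLines hdG hy
  have hddy := hC.act_mem_dLines hdG hdy
  have hdyne := hC.act_ne_of_isAxial hdax hl hy hyd hyl.symm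
  by_cases hwdy : w = act d y
  · have he := hC.conj_mem_centeredAt hdG hg
    rw [← hwdy] at he
    have hne : act d w ≠ y := by
      intro h
      rw [hwdy] at h
      apply hdyne
      have := hC.act_cube (m := y) hd
      rwa [h] at this
    refine contra he hwle (hC.act_mem_dLines hdG hw) hy ?_ hyle hne ?_ (hfixy _ he)
    · exact (act_le_sup hdax.sub_mem).trans (sup_le le_sup_left hwle)
    · rw [fixSpace_conj]
      exact act_mono d hwg
  rcases hC.mem_or_mem_or_apply_eq hd hy hyd (hsup ▸ hwle hu) with h | h | h | h | h
  · exact hwl (hC.eq_of_mem_of_mem hw hl hu0 hu h)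
  · exact hwy (hC.eq_of_mem_of_mem hw hy hu0 hu h)
  · exact hwdy (hC.eq_of_mem_of_mem hw hdy hu0 hu h)
  · have hweq := hC.eq_of_mem_of_mem hw hddy hu0 hu h
    have hw' : act d⁻¹ y = w := by
      rw [← hC.act_cube (m := y) hd, act_inv_act, hweq]
    have he := hC.conj_mem_centeredAt (G.inv_mem hdG) hg
    rw [hw'] at he
    have hne : act d⁻¹ w ≠ y := by
      intro h
      apply hwdy
      rw [← h, act_act_inv]
    refine contra he hwle (hC.act_mem_dLines (G.inv_mem hdG) hw) hy ?_ hyle hne ?_ (hfixy _ he)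
    · exact (act_le_sup (isAxial_inv hdax).sub_mem).trans (sup_le le_sup_left hwle)
    · rw [fixSpace_conj]
      exact act_mono _ hwg
  · exact hwd (hC.le_fixSpace_of_apply_eq hdax hl hw hu hu0 h)

theorem moves_of_isFull (hC : IsLineConfiguration G D) (htr : IsTransitive G D)
    (hl : l ∈ dLines D) (hm : m ∈ dLines D) (hlm : l ≠ m) (hfull : IsFull D l m) :
    Moves G l m := by
  obtain ⟨x, hx, y, hy, hxle, hyle, hxy⟩ := hC.exists_moves_of_isFull hl hm hlm hfull
  have hne := ne_of_moves hxy
  have hsup := hC.sup_eq_sup hl hm hx hy hlm hne hxle hyle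
  by_cases hlx : l = x
  · subst hlx
    exact hC.moves_of_le hl hy hxy hm (hsup ▸ le_sup_right) hlm.symm
  · have h1 := hC.moves_of_le hx hy hxy hl (hsup ▸ le_sup_left) hlx
    have h2 := hC.moves_symm htr hx hl h1
    refine hC.moves_of_le hl hx h2 hm ?_ hlm.symm
    rw [hC.sup_eq_sup hl hm hl hx hlm hlx le_sup_left hxle]
    exact le_sup_right

/-- If the span of `l` and `m` is not full, the vectors fixed by a reflection at `l` are in no
`D`-line. -/
theorem eq_zero_of_not_isFull (hC : IsLineConfiguration G D) (hm : m ∈ dLines D)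
    (hd : d ∈ centeredAt D l) (hdm : ¬ m ≤ fixSpace d)
    (hnf : ¬ IsFull D l m) {v : V} (hv : v ∈ l ⊔ m) (hdv : d v = v) (hp : p ∈ dLines D)
    (hvp : v ∈ p) : v = 0 := by
  by_contra hv0
  have hl := mem_dLines_of_mem hd
  have hdG := hC.mem_group hd
  have hdax := hC.isAxial_of_centeredAt hd
  obtain ⟨f, hf⟩ := exists_mem_centeredAt hp
  have hfax := hC.isAxial_of_centeredAt hf
  have hdmle : act d m ≤ l ⊔ m := act_le_sup hdax.sub_mem
  have hddmle : act d (act d m) ≤ l ⊔ m :=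
    (act_le_sup hdax.sub_mem).trans (sup_le le_sup_left hdmle)
  have hdmL := hC.act_mem_dLines hdG hm
  have hddmL := hC.act_mem_dLines hdG hdmL
  -- If `f` moves `j`, then `f u = u + v` for some `u ∈ j`. This vector is not fixed by `d`, so it
  -- lies in one of the four known `D`-lines of the span. Hence `f j` is in the span, and so is the
  -- center `p`.
  have key : ∀ j ∈ dLines D, j ≤ l ⊔ m → ¬ j ≤ fixSpace d → j ≤ fixSpace f ∨ p ≤ l ⊔ m := by
    intro j hj hjle hjd
    by_contra! hcon
    obtain ⟨hjf, hple⟩ := hcon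
    obtain ⟨u, hu, huv⟩ := hC.exists_sub_eq hfax hp hj hjf hvp
    have hfu : f u = v + u := by rw [← huv]; abel
    have hu0 : u ≠ 0 := by
      rintro rfl
      apply hv0
      simpa using huv.symm
    have hfu0 : f u ≠ 0 := by simpa using hu0
    have hfj := hC.act_mem_dLines hfax.mem hj
    have hfuX : f u ∈ l ⊔ m := hfu ▸ add_mem hv (hjle hu)
    refine hple (hC.le_of_le_of_act_le hfax hp hj hjf hjle ?_)
    rcases hC.mem_or_mem_or_apply_eq hd hm hdm hfuX with h | h | h | h | h
    · exact hC.eq_of_mem_of_mem hfj hl hfu0 (apply_mem_act hu) h ▸ le_sup_left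
    · exact hC.eq_of_mem_of_mem hfj hm hfu0 (apply_mem_act hu) h ▸ le_sup_right
    · exact hC.eq_of_mem_of_mem hfj hdmL hfu0 (apply_mem_act hu) h ▸ hdmle
    · exact hC.eq_of_mem_of_mem hfj hddmL hfu0 (apply_mem_act hu) h ▸ hddmle
    · exfalso
      rw [hfu, map_add, hdv, add_right_inj] at h
      exact hC.apply_ne hdax hl hj hjd hu hu0 h
  have hple : p ≤ l ⊔ m := by
    by_contra hcon
    have h1 := (key l hl le_sup_left (hC.not_le_fixSpace hd)).resolve_right hcon
    have h2 := (key m hm le_sup_right hdm).resolve_right hcon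
    exact hv0 (hC.eq_zero_of_apply_eq hf hvp (mem_fixSpace.1 (sup_le h1 h2 hv)))
  have hpd := hC.le_fixSpace_of_apply_eq hdax hl hp hvp hv0 hdv
  have hlp : l ≠ p := by rintro rfl; exact hC.not_le_fixSpace hd hpd
  have hlm : l ≠ m := by
    rintro rfl
    rw [sup_idem] at hple
    exact hlp (hC.eq_of_le hp hl hple).symm
  -- Now `p` is a fifth `D`-line of the span, consisting of vectors fixed by `d`; together with `l`,
  -- `m`, `d m` and `d² m` it would make the span full.
  have hsup := hC.sup_eq_sup hl hm hl hp hlm hlp le_sup_left hple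
  refine hnf fun w hw => ?_
  rcases hC.mem_or_mem_or_apply_eq hd hm hdm hw with h | h | h | h | h
  · exact ⟨l, hl, le_sup_left, h⟩
  · exact ⟨m, hm, le_sup_right, h⟩
  · exact ⟨_, hdmL, hdmle, h⟩
  · exact ⟨_, hddmL, hddmle, h⟩
  · refine ⟨p, hp, hple, ?_⟩
    rw [← hsup] at hw
    obtain ⟨a, ha, c, hc, rfl⟩ := Submodule.mem_sup.1 hw
    rw [map_add, mem_fixSpace.1 (hpd hc), add_left_inj] at h
    rwa [hC.eq_zero_of_apply_eq hd ha h, zero_add]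

theorem exists_ne_ne (hC : IsLineConfiguration G D) (hl : l ∈ dLines D) (hm : m ∈ dLines D)
    (hlm : l ≠ m) (hd : d ∈ centeredAt D l) (hdm : ¬ m ≤ fixSpace d)
    (x : Submodule (ZMod 2) V) :
    ∃ p ∈ dLines D, ∃ q ∈ dLines D, p ≤ l ⊔ m ∧ q ≤ l ⊔ m ∧ p ≠ q ∧ p ≠ x ∧ q ≠ x := by
  have hdax := hC.isAxial_of_centeredAt hd
  have hdmL := hC.act_mem_dLines hdax.mem hm
  have hdmle : act d m ≤ l ⊔ m := act_le_sup hdax.sub_mem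
  have h1 : act d m ≠ m := hC.act_ne_of_isAxial hdax hl hm hdm hlm
  have h2 : act d m ≠ l := by
    intro h
    rw [← hC.act_eq_of_isAxial hdax hl] at h
    exact hlm (act_injective d h).symm
  by_cases hxl : l = x
  · exact ⟨m, hm, _, hdmL, le_sup_right, hdmle, h1.symm, hxl ▸ hlm.symm, hxl ▸ h2⟩
  by_cases hxm : m = x
  · exact ⟨l, hl, _, hdmL, le_sup_left, hdmle, h2.symm, hxl, hxm ▸ h1⟩
  · exact ⟨l, hl, m, hm, le_sup_left, le_sup_right, hlm, hxl, hxm⟩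

/-- Suppose `z = f v - v` is nonzero. Two distinct `D`-lines `x`, `y` of the span move `k`, and `v =
a + b` with `a ∈ x`, `b ∈ y`. Transvections at `x` and `y` add `a` and `b` to `z`, so `f v = v + z`
lies in an image of `k`. Thus `v` lies in a `D`-line, which `eq_zero_of_not_isFull` forbids for
nonzero `v`. -/
theorem apply_eq_of_not_isFull (hC : IsLineConfiguration G D) (htr : IsTransitive G D)
    (hm : m ∈ dLines D) (hlm : l ≠ m) (hd : d ∈ centeredAt D l)
    (hdm : ¬ m ≤ fixSpace d) (hnf : ¬ IsFull D l m) {v : V} (hv : v ∈ l ⊔ m) (hdv : d v = v)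
    (hx : x ∈ dLines D) (hxle : x ≤ l ⊔ m) (hxk : Moves G x k) (hf : f ∈ centeredAt D k) :
    f v = v := by
  by_contra hfv
  have hl := mem_dLines_of_mem hd
  have hk := mem_dLines_of_mem hf
  have hfG := hC.mem_group hf
  obtain ⟨t, ht, htx⟩ := hC.moves_symm htr hx hk hxk
  obtain ⟨y, hy, hyle, hyx, hty⟩ :
      ∃ y ∈ dLines D, y ≤ l ⊔ m ∧ y ≠ x ∧ ¬ y ≤ fixSpace t := by
    by_contra! hcon
    obtain ⟨p, hp, q, hq, hple, hqle, hpq, hpx, hqx⟩ := hC.exists_ne_ne hl hm hlm hd hdm x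
    exact htx (hxle.trans (hC.sup_le_of_le hl hm hp hq hlm hpq hple hqle
      (hcon p hp hple hpx) (hcon q hq hqle hqx)))
  have hyk : Moves G y k := hC.moves_symm htr hk hy ⟨t, ht, hty⟩
  have hsup := hC.sup_eq_sup hl hm hx hy hlm hyx.symm hxle hyle
  have hyx' : ¬ Moves G y x := fun h => hnf (hC.isFull_congr hl hm hy hx hlm hyx hyle hxle
    (hC.isFull_of_moves hy hx h))
  have hz : f v - v ∈ k := sub_mem_of_mem hf v
  have hz0 : f v - v ≠ 0 := sub_ne_zero.2 hfv
  obtain ⟨a, ha, b, hb, hab⟩ := Submodule.mem_sup.1 (hsup ▸ hv)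
  obtain ⟨s, hs, hsk⟩ := hxk
  obtain ⟨r, hr, hrk⟩ := hyk
  obtain ⟨s, hs, hsz, -⟩ := hC.exists_transvection_apply hx hs hk hsk ha hz hz0
  obtain ⟨r, hr, hrz, -⟩ := hC.exists_transvection_apply hy hr hk hrk hb hz hz0
  have hra : r a = a := by
    by_contra hne
    exact hyx' ⟨r, hr, fun hle => hne (mem_fixSpace.1 (hle ha))⟩
  have hmem : f v ∈ act r (act s k) := by
    have : r (s (f v - v)) = f v := by
      rw [hsz, map_add, hra, hrz, ← hab]
      abel
    rw [← this]
    exact apply_mem_act (apply_mem_act hz)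
  have hL := hC.act_mem_dLines (G.inv_mem hfG)
    (hC.act_mem_dLines hr.1 (hC.act_mem_dLines hs.1 hk))
  have hvp := apply_mem_act (g := f⁻¹) hmem
  rw [inv_apply_self'] at hvp
  have := hC.eq_zero_of_not_isFull hm hd hdm hnf hv hdv hL hvp
  exact hfv (by simp [this])

theorem isFull_act (hC : IsLineConfiguration G D) (hg : g ∈ G) (h : IsFull D l m) :
    IsFull D (act g l) (act g m) := by
  intro v hv
  rw [← act_sup, mem_act] at hv
  obtain ⟨p, hp, hple, hvp⟩ := h _ hv
  exact ⟨act g p, hC.act_mem_dLines hg hp, by rw [← act_sup]; exact act_mono g hple,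
    mem_act.2 hvp⟩

/-- Transvections at `l` fix `k`, so the commutator of `f` and `t` is a transvection at `k`. If it
fixed `y`, then `f` would fix `t⁻¹ y` besides `y`, hence the center `l` of `t`. -/
theorem moves_of_commutator (hC : IsLineConfiguration G D) (hl : l ∈ dLines D)
    (hy : y ∈ dLines D) (hf : f ∈ centeredAt D k) (hfl : ¬ l ≤ fixSpace f)
    (hlk : ¬ Moves G l k) (hly : Moves G l y) (hfy : y ≤ fixSpace f) : Moves G k y := by
  have hfax := hC.isAxial_of_centeredAt hf
  obtain ⟨t, ht, hty⟩ := hly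
  have htk : k ≤ fixSpace t := by
    by_contra hc
    exact hlk ⟨t, ht, hc⟩
  have hf' := hC.conj_mem_centeredAt ht.1 hf
  rw [act_eq_self htk] at hf'
  refine ⟨f⁻¹ * (t * f * t⁻¹), ⟨G.mul_mem (G.inv_mem hfax.mem) (hC.mem_group hf'), fun v => ?_,
    fun v hv => ?_⟩, fun hle => hfl ?_⟩
  · have := k.add_mem ((isAxial_inv hfax).sub_mem ((t * f * t⁻¹) v)) (sub_mem_of_mem hf' v)
    rwa [sub_add_sub_cancel] at this
  · rw [mem_fixSpace]
    change f⁻¹ (t (f (t⁻¹ v))) = v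
    have h1 : t⁻¹ v = v := mem_fixSpace.1 (fixSpace_inv t ▸ htk hv)
    rw [h1, mem_fixSpace.1 (htk (apply_mem hf hv)), inv_apply_self']
  · refine hC.le_of_le_of_act_le (isAxial_inv (isAxial_of_transvections ht)) hl hy
      (by rwa [fixSpace_inv]) hfy ?_
    rintro _ ⟨v, hv, rfl⟩
    have h1 : f⁻¹ (t (f (t⁻¹ v))) = v := mem_fixSpace.1 (hle hv)
    have h2 : f v = v := mem_fixSpace.1 (hfy hv)
    have h3 : t (f (t⁻¹ v)) = v := by
      rw [← apply_inv_self' f (t (f (t⁻¹ v))), h1, h2]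
    rw [mem_fixSpace]
    change f (t⁻¹ v) = t⁻¹ v
    nth_rw 2 [← h3]
    rw [inv_apply_self']

/-- If `G` fixes no nonzero vector, then non-commuting reflections span a full space. -/
theorem isFull_of_not_le_fixSpace (hC : IsLineConfiguration G D) (htr : IsTransitive G D)
    (hfix : ∀ v, (∀ f ∈ D, f v = v) → v = 0)
    (hmv : ∀ l ∈ dLines D, ∃ m ∈ dLines D, Moves G l m)
    (hm : m ∈ dLines D) (hlm : l ≠ m) (hd : d ∈ centeredAt D l)
    (hdm : ¬ m ≤ fixSpace d) : IsFull D l m := by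
  by_contra hnf
  have hl := mem_dLines_of_mem hd
  have hdax := hC.isAxial_of_centeredAt hd
  obtain ⟨v, hv, hv0, hdv⟩ : ∃ v ∈ l ⊔ m, v ≠ 0 ∧ d v = v := by
    -- Since `d - 1` maps `m` onto `l`, some `b ∈ m` has the same displacement as `a ∈ l`, and `b -
    -- a` is fixed.
    obtain ⟨a, ha, ha0⟩ := hC.exists_ne_zero hl
    obtain ⟨b, hb, hab⟩ := hC.exists_sub_eq hdax hl hm hdm (sub_mem_of_mem hd a)
    refine ⟨b - a, sub_mem (Submodule.mem_sup_right hb) (Submodule.mem_sup_left ha), ?_, ?_⟩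
    · intro h
      rw [sub_eq_zero] at h
      exact hlm (hC.eq_of_mem_of_mem hl hm ha0 ha (h ▸ hb))
    · rw [map_sub]
      linear_combination (norm := module) hab
  refine hv0 (hfix v fun f hfD => ?_)
  obtain ⟨k, hk⟩ : ∃ k, k = commSpace f := ⟨_, rfl⟩
  have hf : f ∈ centeredAt D k := ⟨hfD, hk.symm⟩
  have hkL := mem_dLines_of_mem hf
  have hfax := hC.isAxial_of_centeredAt hf
  by_contra hfv
  obtain ⟨x, hx, hxle, hxf⟩ : ∃ x ∈ dLines D, x ≤ l ⊔ m ∧ ¬ x ≤ fixSpace f := by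
    by_contra! hcon
    exact hfv (mem_fixSpace.1 (sup_le (hcon l hl le_sup_left) (hcon m hm le_sup_right) hv))
  have hxk : ¬ Moves G x k := fun h =>
    hfv (hC.apply_eq_of_not_isFull htr hm hlm hd hdm hnf hv hdv hx hxle h hf)
  obtain ⟨z, hz, hxz⟩ := hmv x hx
  obtain ⟨y, hy, hyle, hyf⟩ := hC.exists_le_fixSpace hfax hkL hx hz (ne_of_moves hxz)
    (hC.isFull_of_moves hx hz hxz)
  have hxy : Moves G x y := hC.moves_of_le hx hz hxz hy hyle (by rintro rfl; exact hxf hyf)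
  -- A reflection `g` at `y` moves `k`. It nevertheless fixes `v` and, by the same argument in the
  -- image of the span under `f`, also `f v`. So it fixes the nonzero vector `f v - v` of `k`, a
  -- contradiction.
  have hky := hC.moves_of_commutator hx hy hf hxf hxk hxy hyf
  obtain ⟨g, hg, hgk⟩ := hC.exists_centeredAt_of_moves hkL hy (hC.moves_symm htr hkL hy hky)
  have h1 : g v = v := hC.apply_eq_of_not_isFull htr hm hlm hd hdm hnf hv hdv hx hxle hxy hg
  have h2 : g (f v) = f v := by
    have hxy' := moves_act hfax.mem hxy
    rw [act_eq_self hyf] at hxy'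
    refine hC.apply_eq_of_not_isFull htr (hC.act_mem_dLines hfax.mem hm)
      (fun h => hlm (act_injective f h)) (hC.conj_mem_centeredAt hfax.mem hd) ?_ ?_ ?_ ?_
      (hC.act_mem_dLines hfax.mem hx) ?_ hxy' hg
    · rwa [fixSpace_conj, act_le_iff]
    · intro h
      have := hC.isFull_act (G.inv_mem hfax.mem) h
      rw [act_inv_act, act_inv_act] at this
      exact hnf this
    · rw [← act_sup]
      exact apply_mem_act hv
    · change f (d (f⁻¹ (f v))) = f v
      rw [inv_apply_self', hdv]
    · rw [← act_sup]
      exact act_mono f hxle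
  refine hgk (hC.le_fixSpace_of_apply_eq (hC.isAxial_of_centeredAt hg) hy hkL
    (sub_mem_of_mem hf v) (sub_ne_zero.2 hfv) ?_)
  rw [map_sub, h1, h2]

/-- If `l` does not move `m`, the two lines fix each other. Starting from a line `y` moved by both,
transvections `t` at `l` and `s` at `m` give lines `t y` and `s y` whose span is full. It contains
the vector `(t u - u) - (s u - u)`, with nonzero components in `l` and `m`. The `D`-line `p` through
this vector moves neither `l` nor `m`, so its reflections fix both components and hence a nonzero
vector of their own center. -/
theorem moves_trans (hC : IsLineConfiguration G D) (htr : IsTransitive G D)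
    (hfix : ∀ v, (∀ f ∈ D, f v = v) → v = 0)
    (hmv : ∀ l ∈ dLines D, ∃ m ∈ dLines D, Moves G l m)
    (hl : l ∈ dLines D) (hx : x ∈ dLines D) (hm : m ∈ dLines D) (hlm : l ≠ m)
    (hlx : Moves G l x) (hxm : Moves G x m) : Moves G l m := by
  by_contra hcon
  have fix_of_not_moves : ∀ {p q : Submodule (ZMod 2) V}, q ∈ dLines D → p ≠ q →
      ¬ Moves G p q → ∀ d ∈ centeredAt D p, q ≤ fixSpace d := by
    intro p q hq hpq hnot d hd
    by_contra hc
    exact hnot (hC.moves_of_isFull htr (mem_dLines_of_mem hd) hq hpq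
      (hC.isFull_of_not_le_fixSpace htr hfix hmv hq hpq hd hc))
  have hml : ¬ Moves G m l := fun h => hcon (hC.moves_symm htr hm hl h)
  have hTl : ∀ t ∈ transvections G l, m ≤ fixSpace t := by
    intro t ht; by_contra hc; exact hcon ⟨t, ht, hc⟩
  have hTm : ∀ t ∈ transvections G m, l ≤ fixSpace t := by
    intro t ht; by_contra hc; exact hml ⟨t, ht, hc⟩
  obtain ⟨e, he⟩ := exists_mem_centeredAt hm
  have heax := hC.isAxial_of_centeredAt he
  have hel : l ≤ fixSpace e := fix_of_not_moves hl hlm.symm hml e he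
  have hmx := hC.moves_symm htr hx hm hxm
  obtain ⟨y, hy, hyle, hye⟩ := hC.exists_le_fixSpace heax hm hm hx (ne_of_moves hmx)
    (hC.isFull_of_moves hm hx hmx)
  have hym : y ≠ m := by rintro rfl; exact hC.not_le_fixSpace he hye
  obtain ⟨s, hs, hsy⟩ := hC.moves_of_le hm hx hmx hy hyle hym
  have hym' : Moves G y m := hC.moves_symm htr hm hy ⟨s, hs, hsy⟩
  obtain ⟨t, ht, hty⟩ : Moves G l y := by
    obtain ⟨t, ht, htx⟩ := hlx
    refine ⟨t, ht, fun hle => htx (le_sup_right.trans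
      (hC.sup_le_of_le hm hx hm hy (ne_of_moves hmx) hym.symm le_sup_left hyle (hTl t ht) hle))⟩
  have htyL := hC.act_mem_dLines ht.1 hy
  have hsyL := hC.act_mem_dLines hs.1 hy
  have hsax := isAxial_of_transvections hs
  have hsyne : act s y ≠ y := hC.act_ne_of_isAxial hsax hm hy hsy hym.symm
  have hsyle : act s y ≤ m ⊔ y := act_le_sup hs.2.1
  have hse : ¬ act s y ≤ fixSpace e := fun hle => hC.not_le_fixSpace he
    (le_sup_left.trans (hC.sup_le_of_le hm hy hsyL hy hym.symm hsyne hsyle le_sup_right hle hye))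
  have hte : act t y ≤ fixSpace e := (act_le_sup ht.2.1).trans (sup_le hel hye)
  have htm : Moves G (act t y) m := by
    have := moves_act ht.1 hym'
    rwa [act_eq_self (hTl t ht)] at this
  -- Otherwise a transvection at `t y` moving `m` fixes `s y` and, since `e` fixes `t y`, also `e⁻¹
  -- (s y)`. It then fixes the center `m` of `e`.
  have hts : Moves G (act t y) (act s y) := by
    by_contra hnot
    obtain ⟨r, hr, hrm⟩ := htm
    have h1 : act s y ≤ fixSpace r := by by_contra hc; exact hnot ⟨r, hr, hc⟩
    have h2 : act e⁻¹ (act s y) ≤ fixSpace r := by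
      have hr' := conj_mem_transvections heax.mem hr
      rw [act_eq_self hte] at hr'
      have h3 : act s y ≤ fixSpace (e * r * e⁻¹) := by by_contra hc; exact hnot ⟨_, hr', hc⟩
      rw [fixSpace_conj] at h3
      have := act_mono e⁻¹ h3
      rwa [act_inv_act] at this
    exact hrm (hC.le_of_le_of_act_le (isAxial_inv heax) hm hsyL (by rwa [fixSpace_inv]) h1 h2)
  obtain ⟨u, hu, hu0⟩ := hC.exists_ne_zero hy
  have ha : t u - u ∈ l := ht.2.1 u
  have hb : s u - u ∈ m := hs.2.1 u
  have ha0 : t u - u ≠ 0 :=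
    sub_ne_zero.2 (hC.apply_ne (isAxial_of_transvections ht) hl hy hty hu hu0)
  have hb0 : s u - u ≠ 0 := sub_ne_zero.2 (hC.apply_ne hsax hm hy hsy hu hu0)
  obtain ⟨p, hp, -, hcp⟩ := hC.isFull_of_moves htyL hsyL hts (t u - s u)
    (sub_mem (Submodule.mem_sup_left (apply_mem_act hu))
      (Submodule.mem_sup_right (apply_mem_act hu)))
  have hc : t u - s u = (t u - u) - (s u - u) := by abel
  rw [hc] at hcp
  have hpl : p ≠ l := by
    rintro rfl
    exact hlm (hC.eq_of_mem_of_mem hp hm hb0 (by simpa using sub_mem ha hcp) hb)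
  have hpm : p ≠ m := by
    rintro rfl
    exact hlm (hC.eq_of_mem_of_mem hl hp ha0 ha (by simpa using add_mem hcp hb))
  have hc0 : (t u - u) - (s u - u) ≠ 0 := by
    intro h
    rw [sub_eq_zero] at h
    exact hlm (hC.eq_of_mem_of_mem hl hm ha0 ha (h ▸ hb))
  have hpl' : ¬ Moves G p l := by
    intro h
    obtain ⟨r, hr, hrp⟩ := hC.moves_symm htr hp hl h
    refine hC.apply_ne (isAxial_of_transvections hr) hl hp hrp hcp hc0 ?_
    rw [map_sub, mem_fixSpace.1 (hr.2.2 ha), mem_fixSpace.1 (hTl r hr hb)]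
  have hpm' : ¬ Moves G p m := by
    intro h
    obtain ⟨r, hr, hrp⟩ := hC.moves_symm htr hp hm h
    refine hC.apply_ne (isAxial_of_transvections hr) hm hp hrp hcp hc0 ?_
    rw [map_sub, mem_fixSpace.1 (hTm r hr ha), mem_fixSpace.1 (hr.2.2 hb)]
  obtain ⟨g, hg⟩ := exists_mem_centeredAt hp
  refine hc0 (hC.eq_zero_of_apply_eq hg hcp ?_)
  rw [map_sub, mem_fixSpace.1 (fix_of_not_moves hl hpl hpl' g hg ha),
    mem_fixSpace.1 (fix_of_not_moves hm hpm hpm' g hg hb)]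

end IsLineConfiguration

/-! ### Spreads cover their four-space -/

section Counting

variable {V : Type*} [AddCommGroup V] [Module (ZMod 2) V]

theorem finite_of_finrank_pos {W : Submodule (ZMod 2) V} (h : 0 < Module.finrank (ZMod 2) W) :
    (W : Set V).Finite := by
  have : FiniteDimensional (ZMod 2) W := Module.finite_of_finrank_pos h
  have : Finite W := Module.finite_of_finite (ZMod 2)
  exact Set.toFinite _

theorem ncard_diff_zero {W : Submodule (ZMod 2) V} (h : 0 < Module.finrank (ZMod 2) W) :
    ((W : Set V) \ {0}).ncard = 2 ^ Module.finrank (ZMod 2) W - 1 := by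
  have : FiniteDimensional (ZMod 2) W := Module.finite_of_finrank_pos h
  rw [Set.ncard_sdiff_singleton_of_mem W.zero_mem]
  congr 1
  change Nat.card W = _
  rw [Module.natCard_eq_pow_finrank (K := ZMod 2)]
  simp

theorem ncard_biUnion_diff_zero {S : Set (Submodule (ZMod 2) V)} (hS : S.Finite)
    (h2 : ∀ l ∈ S, Module.finrank (ZMod 2) l = 2)
    (hinf : ∀ l ∈ S, ∀ m ∈ S, l ≠ m → l ⊓ m = ⊥) :
    (⋃ l ∈ S, ((l : Set V) \ {0})).ncard = 3 * S.ncard := by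
  classical
  have hfin : ∀ l ∈ S, ((l : Set V) \ {0}).Finite := fun l hl =>
    (finite_of_finrank_pos (by rw [h2 l hl]; norm_num)).subset Set.sdiff_subset
  let f : Submodule (ZMod 2) V → Finset V := fun l =>
    if h : ((l : Set V) \ {0}).Finite then h.toFinset else ∅
  have hf : ∀ l ∈ S, (f l : Set V) = (l : Set V) \ {0} := by
    intro l hl
    simp [f, hfin l hl]
  have hcard : ∀ l ∈ hS.toFinset, (f l).card = 3 := by
    intro l hl
    have hl' := hS.mem_toFinset.1 hl
    rw [← Set.ncard_coe_finset, hf l hl', ncard_diff_zero (by rw [h2 l hl']; norm_num), h2 l hl']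
    norm_num
  have hdisj : ((hS.toFinset : Finset _) : Set (Submodule (ZMod 2) V)).PairwiseDisjoint f := by
    intro l hl m hm hlm
    rw [hS.coe_toFinset] at hl hm
    rw [Function.onFun, ← Finset.disjoint_coe, hf l hl, hf m hm, Set.disjoint_left]
    rintro v ⟨hvl, hv0⟩ ⟨hvm, -⟩
    have : v ∈ l ⊓ m := ⟨hvl, hvm⟩
    rw [hinf l hl m hm hlm] at this
    exact hv0 this
  have hU : (⋃ l ∈ S, ((l : Set V) \ {0})) = (hS.toFinset.biUnion f : Finset V) := by
    rw [Finset.coe_biUnion, hS.coe_toFinset]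
    exact Set.iUnion₂_congr fun l hl => (hf l hl).symm
  rw [hU, Set.ncard_coe_finset, Finset.card_biUnion hdisj, Finset.sum_congr rfl hcard,
    Finset.sum_const, smul_eq_mul, mul_comm, Set.ncard_eq_toFinset_card S hS]

/-- Five planes with three nonzero vectors each, pairwise disjoint away from zero, account for all
`15 = 2⁴ - 1` nonzero vectors. -/
theorem IsSpreadOf.exists_mem {W : Submodule (ZMod 2) V} {S : Set (Submodule (ZMod 2) V)}
    (h : IsSpreadOf W S) {v : V} (hv : v ∈ W) (hv0 : v ≠ 0) : ∃ l ∈ S, v ∈ l := by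
  have hS : S.Finite := Set.finite_of_ncard_ne_zero (by rw [h.ncard_eq_five]; norm_num)
  have hW : 0 < Module.finrank (ZMod 2) W := by rw [h.finrank_eq_four]; norm_num
  have h1 := ncard_biUnion_diff_zero hS h.finrank_eq_two h.inf_eq_bot
  have h2 := ncard_diff_zero hW
  rw [h.ncard_eq_five] at h1
  rw [h.finrank_eq_four] at h2
  have hsub : (⋃ l ∈ S, ((l : Set V) \ {0})) ⊆ (W : Set V) \ {0} :=
    Set.iUnion₂_subset fun l hl => Set.sdiff_subset_sdiff_left (h.le l hl)
  have := Set.eq_of_subset_of_ncard_le hsub (by rw [h1, h2]; norm_num)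
    ((finite_of_finrank_pos hW).subset Set.sdiff_subset)
  have hmem : v ∈ ⋃ l ∈ S, ((l : Set V) \ {0}) := this ▸ ⟨hv, hv0⟩
  simp only [Set.mem_iUnion] at hmem
  obtain ⟨l, hl, hvl⟩ := hmem
  exact ⟨l, hl, hvl.1⟩

theorem isSpreadOf_of_forall_exists_mem {W : Submodule (ZMod 2) V}
    {S : Set (Submodule (ZMod 2) V)} (hW : Module.finrank (ZMod 2) W = 4)
    (hle : ∀ l ∈ S, l ≤ W) (h2 : ∀ l ∈ S, Module.finrank (ZMod 2) l = 2)
    (hinf : ∀ l ∈ S, ∀ m ∈ S, l ≠ m → l ⊓ m = ⊥) (hcov : ∀ v ∈ W, ∃ l ∈ S, v ∈ l) :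
    IsSpreadOf W S := by
  have hW0 : 0 < Module.finrank (ZMod 2) W := by rw [hW]; norm_num
  have hWfin := finite_of_finrank_pos hW0
  have hS : S.Finite := by
    refine Set.Finite.of_finite_image (f := fun l : Submodule (ZMod 2) V => (l : Set V)) ?_
      SetLike.coe_injective.injOn
    exact hWfin.finite_subsets.subset (by rintro _ ⟨l, hl, rfl⟩; exact hle l hl)
  refine ⟨hW, ?_, hle, h2, hinf⟩
  have hU : (⋃ l ∈ S, ((l : Set V) \ {0})) = (W : Set V) \ {0} := by
    refine Set.Subset.antisymm
      (Set.iUnion₂_subset fun l hl => Set.sdiff_subset_sdiff_left (hle l hl)) ?_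
    rintro v ⟨hv, hv0⟩
    obtain ⟨l, hl, hvl⟩ := hcov v hv
    exact Set.mem_biUnion hl ⟨hvl, hv0⟩
  have h1 := ncard_biUnion_diff_zero hS h2 hinf
  rw [hU, ncard_diff_zero hW0, hW] at h1
  omega

end Counting

/-! ### The geometry `Δ` is a projective space -/

namespace IsLineConfiguration

variable {V : Type*} [AddCommGroup V] [Module (ZMod 2) V]
  {G : Subgroup (V ≃ₗ[ZMod 2] V)} {D : Set (V ≃ₗ[ZMod 2] V)}
  {k l m p q x y U : Submodule (ZMod 2) V} {d e f g h t : V ≃ₗ[ZMod 2] V}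

theorem sup_eq_of_isSpreadOf (hC : IsLineConfiguration G D) {W : Submodule (ZMod 2) V}
    {S : Set (Submodule (ZMod 2) V)} (hS : IsSpreadOf W S) (hl : l ∈ dLines D)
    (hm : m ∈ dLines D) (hlm : l ≠ m) (hlW : l ≤ W) (hmW : m ≤ W) : l ⊔ m = W := by
  have : FiniteDimensional (ZMod 2) W :=
    Module.finite_of_finrank_pos (by rw [hS.finrank_eq_four]; norm_num)
  exact Submodule.eq_of_le_of_finrank_eq (sup_le hlW hmW)
    (by rw [hC.finrank_sup hl hm hlm, hS.finrank_eq_four])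

theorem isFull_of_isSpreadOf (hC : IsLineConfiguration G D) {W : Submodule (ZMod 2) V}
    {S : Set (Submodule (ZMod 2) V)} (hS : IsSpreadOf W S) (hSD : S ⊆ dLines D) (hl : l ∈ S)
    (hm : m ∈ S) (hlm : l ≠ m) : IsFull D l m := by
  intro v hv
  have hsup := hC.sup_eq_of_isSpreadOf hS (hSD hl) (hSD hm) hlm (hS.le l hl) (hS.le m hm)
  by_cases hv0 : v = 0
  · exact ⟨l, hSD hl, le_sup_left, by simp [hv0]⟩
  rw [hsup] at hv ⊢
  obtain ⟨p, hp, hvp⟩ := hS.exists_mem hv hv0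
  exact ⟨p, hSD hp, hS.le p hp, hvp⟩

theorem commSpace_le_of_mem_closure {s : Set (V ≃ₗ[ZMod 2] V)} (hU : ∀ d ∈ s, commSpace d ≤ U)
    (hg : g ∈ Subgroup.closure s) : commSpace g ≤ U := by
  have key : ∀ v, g v - v ∈ U := by
    induction hg using Subgroup.closure_induction with
    | mem d hd => exact fun v => hU d hd (mem_commSpace.2 ⟨v, rfl⟩)
    | one => intro v; simp
    | mul a b _ _ iha ihb =>
      intro v
      have := U.add_mem (iha (b v)) (ihb v)
      rwa [sub_add_sub_cancel] at this
    | inv a _ ih =>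
      intro v
      have := U.neg_mem (ih (a⁻¹ v))
      rwa [apply_inv_self', neg_sub] at this
  intro x hx
  obtain ⟨v, rfl⟩ := mem_commSpace.1 hx
  exact key v

/-- There are no tangent spreads if non-commuting reflections span full spaces. -/
theorem not_isTangentSpread (hC : IsLineConfiguration G D)
    (hnc : ∀ l m, m ∈ dLines D → l ≠ m → ∀ d ∈ centeredAt D l, ¬ m ≤ fixSpace d → IsFull D l m)
    {S : Set (Submodule (ZMod 2) V)} : ¬ IsTangentSpread D S := by
  rintro ⟨d, hd, e, he, hne, hnot, hcard, hS, hsub⟩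
  have hfull := hnc _ _ ⟨e, he, rfl⟩ hne d ⟨hd, rfl⟩ hnot
  have hle : ∀ g ∈ ({d, e} : Set (V ≃ₗ[ZMod 2] V)),
      commSpace g ≤ groupCommSpace (Subgroup.closure {d, e}) := fun g hg =>
    le_iSup₂_of_le g (Subgroup.subset_closure hg) le_rfl
  have hsup := hC.sup_eq_of_isSpreadOf hS ⟨d, hd, rfl⟩ ⟨e, he, rfl⟩ hne (hle d (by simp))
    (hle e (by simp))
  obtain ⟨q, hq, hqn⟩ := Set.exists_of_ssubset (hsub.ssubset_of_ne (by
    intro h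
    rw [h, hS.ncard_eq_five] at hcard
    norm_num at hcard))
  have hq0 : q ≠ ⊥ := by
    rintro rfl
    have := hS.finrank_eq_two _ hq
    simp at this
  obtain ⟨v, hv, hv0⟩ := (Submodule.ne_bot_iff q).1 hq0
  -- The member `q` of the spread is not a `D`-line, yet fullness puts its vector `v` in a `D`-line
  -- `p`, which is another member of the spread.
  obtain ⟨p, hp, hple, hvp⟩ := hfull v (hsup ▸ hS.le q hq hv)
  have hpS := hsub ⟨hp, hsup ▸ hple⟩
  by_cases hpq : p = q
  · exact hqn (hpq ▸ ⟨hp, hsup ▸ hple⟩)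
  · have : v ∈ p ⊓ q := ⟨hvp, hv⟩
    rw [hS.inf_eq_bot p hpS q hq hpq] at this
    exact hv0 this

theorem exists_isSpreadOf_of_mem_deltaLines (hC : IsLineConfiguration G D)
    (hnc : ∀ l m, m ∈ dLines D → l ≠ m → ∀ d ∈ centeredAt D l, ¬ m ≤ fixSpace d → IsFull D l m)
    {b : Set (Submodule (ZMod 2) V)} (hb : b ∈ deltaLines D) :
    b ⊆ dLines D ∧ ∃ W, IsSpreadOf W b := by
  obtain ⟨S, hS | hS, rfl⟩ := hb
  · obtain ⟨W, hW, hSD⟩ := hS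
    rw [Set.inter_eq_left.2 hSD]
    exact ⟨hSD, W, hW⟩
  · exact absurd hS (hC.not_isTangentSpread hnc)

theorem exists_ne_of_isSpreadOf {W : Submodule (ZMod 2) V} {S : Set (Submodule (ZMod 2) V)}
    (hS : IsSpreadOf W S) : ∃ l ∈ S, ∃ m ∈ S, l ≠ m := by
  have h5 := hS.ncard_eq_five
  have : S.Finite := Set.finite_of_ncard_ne_zero (by rw [h5]; norm_num)
  exact (Set.one_lt_ncard this).1 (by rw [h5]; norm_num)

/-- In a connected configuration with a full spread and trivial centralizer, transvections at one
`D`-line move all others. -/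
theorem moves_of_ne (hC : IsLineConfiguration G D) (htr : IsTransitive G D)
    (hfix : ∀ v, (∀ f ∈ D, f v = v) → v = 0)
    (hconn : IsConnectedGeometry (dLines D) (deltaLines D)) (hfull : ∃ S, IsFullSpread D S)
    (hl : l ∈ dLines D) (hm : m ∈ dLines D) (hlm : l ≠ m) : Moves G l m := by
  have hmv : ∀ l ∈ dLines D, ∃ m ∈ dLines D, Moves G l m := by
    intro l hl
    obtain ⟨S, W, hW, hSD⟩ := hfull
    obtain ⟨p, hp, q, hq, hpq⟩ := exists_ne_of_isSpreadOf hW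
    have h1 := hC.moves_of_isFull htr (hSD hp) (hSD hq) hpq
      (hC.isFull_of_isSpreadOf hW hSD hp hq hpq)
    obtain ⟨g, hg, rfl⟩ := htr p (hSD hp) l hl
    exact ⟨_, hC.act_mem_dLines hg (hSD hq), moves_act hg h1⟩
  have hnc : ∀ l m, m ∈ dLines D → l ≠ m → ∀ d ∈ centeredAt D l, ¬ m ≤ fixSpace d →
      IsFull D l m := fun l m hm hlm d hd hdm =>
    hC.isFull_of_not_le_fixSpace htr hfix hmv hm hlm hd hdm
  have hstep : ∀ x y, (∃ b ∈ deltaLines D, x ∈ b ∧ y ∈ b) →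
      y ∈ dLines D ∧ (x = y ∨ x ∈ dLines D ∧ Moves G x y) := by
    rintro x y ⟨b, hb, hxb, hyb⟩
    obtain ⟨hbD, W, hW⟩ := hC.exists_isSpreadOf_of_mem_deltaLines hnc hb
    refine ⟨hbD hyb, ?_⟩
    by_cases hxy : x = y
    · exact Or.inl hxy
    · exact Or.inr ⟨hbD hxb, hC.moves_of_isFull htr (hbD hxb) (hbD hyb) hxy
        (hC.isFull_of_isSpreadOf hW hbD hxb hyb hxy)⟩
  have key : ∀ m, Relation.ReflTransGen (fun x y => ∃ b ∈ deltaLines D, x ∈ b ∧ y ∈ b) l m →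
      l ≠ m → Moves G l m := by
    intro m h
    induction h with
    | refl => exact fun h => absurd rfl h
    | @tail y z _ hyz ih =>
      intro hlz
      obtain ⟨hz, rfl | ⟨hy, hyz⟩⟩ := hstep _ _ hyz
      · exact ih hlz
      · by_cases hly : l = y
        · rwa [hly]
        · exact hC.moves_trans htr hfix hmv hl hy hz hlz (ih hly) hyz
  exact key m (hconn l hl m hm) hlm

theorem isFull_of_forall_moves (hC : IsLineConfiguration G D)
    (hall : ∀ l ∈ dLines D, ∀ m ∈ dLines D, l ≠ m → Moves G l m)
    (hl : l ∈ dLines D) (hm : m ∈ dLines D) : IsFull D l m := by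
  by_cases hlm : l = m
  · subst hlm
    intro v hv
    exact ⟨l, hl, le_sup_left, by simpa using hv⟩
  · exact hC.isFull_of_moves hl hm (hall l hl m hm hlm)

/-- Full spans make the union of all `D`-lines closed under addition. It is therefore a subspace,
and it contains `[V, G]`. -/
theorem exists_dLine_mem (hC : IsLineConfiguration G D)
    (hall : ∀ l ∈ dLines D, ∀ m ∈ dLines D, l ≠ m → Moves G l m)
    (hcomm : groupCommSpace G = ⊤) (hne : (dLines D).Nonempty) (v : V) :
    ∃ l ∈ dLines D, v ∈ l := by
  let U : Submodule (ZMod 2) V :=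
    { carrier := {v | ∃ l ∈ dLines D, v ∈ l}
      zero_mem' := by
        obtain ⟨l, hl⟩ := hne
        exact ⟨l, hl, l.zero_mem⟩
      add_mem' := by
        rintro a b ⟨l, hl, ha⟩ ⟨m, hm, hb⟩
        obtain ⟨p, hp, -, hv⟩ := hC.isFull_of_forall_moves hall hl hm (a + b)
          (Submodule.add_mem_sup ha hb)
        exact ⟨p, hp, hv⟩
      smul_mem' := by
        rintro c a ⟨l, hl, ha⟩
        exact ⟨l, hl, l.smul_mem c ha⟩ }
  have hU : groupCommSpace G ≤ U := by
    refine iSup₂_le fun g hg => ?_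
    rw [← hC.closure_eq] at hg
    exact commSpace_le_of_mem_closure (fun d hd x hx => ⟨_, ⟨d, hd, rfl⟩, hx⟩) hg
  rw [hcomm] at hU
  exact hU (Submodule.mem_top (x := v))

theorem isSpreadOf_sup (hC : IsLineConfiguration G D)
    (hall : ∀ l ∈ dLines D, ∀ m ∈ dLines D, l ≠ m → Moves G l m)
    (hl : l ∈ dLines D) (hm : m ∈ dLines D) (hlm : l ≠ m) :
    IsSpreadOf (l ⊔ m) {p ∈ dLines D | p ≤ l ⊔ m} := by
  refine isSpreadOf_of_forall_exists_mem (hC.finrank_sup hl hm hlm) (fun p hp => hp.2)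
    (fun p hp => hC.finrank_dLine hp.1) (fun p hp q hq => hC.disjoint_dLines hp.1 hq.1)
    (fun v hv => ?_)
  obtain ⟨p, hp, hple, hvp⟩ := hC.isFull_of_forall_moves hall hl hm v hv
  exact ⟨p, ⟨hp, hple⟩, hvp⟩

/-- As all spans are full there are no tangent spreads. A full spread contains every `D`-line of its
four-space, since such a line shares a nonzero vector with some member. -/
theorem deltaLines_eq (hC : IsLineConfiguration G D)
    (hall : ∀ l ∈ dLines D, ∀ m ∈ dLines D, l ≠ m → Moves G l m) :
    deltaLines D = {b | ∃ l ∈ dLines D, ∃ m ∈ dLines D, l ≠ m ∧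
      b = {p ∈ dLines D | p ≤ l ⊔ m}} := by
  ext b
  constructor
  · intro hb
    obtain ⟨hbD, W, hW⟩ := hC.exists_isSpreadOf_of_mem_deltaLines
      (fun l m hm hlm d hd _ => hC.isFull_of_forall_moves hall (mem_dLines_of_mem hd) hm) hb
    obtain ⟨l, hl, m, hm, hlm⟩ := exists_ne_of_isSpreadOf hW
    have hsup := hC.sup_eq_of_isSpreadOf hW (hbD hl) (hbD hm) hlm (hW.le l hl) (hW.le m hm)
    refine ⟨l, hbD hl, m, hbD hm, hlm, ?_⟩
    ext p
    rw [hsup]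
    refine ⟨fun hp => ⟨hbD hp, hW.le p hp⟩, ?_⟩
    rintro ⟨hp, hple⟩
    obtain ⟨v, hv, hv0⟩ := hC.exists_ne_zero hp
    obtain ⟨q, hq, hvq⟩ := hW.exists_mem (hple hv) hv0
    rwa [hC.eq_of_mem_of_mem hp (hbD hq) hv0 hv hvq]
  · rintro ⟨l, hl, m, hm, hlm, rfl⟩
    refine ⟨{p ∈ dLines D | p ≤ l ⊔ m}, Or.inl ⟨_, hC.isSpreadOf_sup hall hl hm hlm,
      fun p hp => hp.1⟩, ?_⟩
    exact (Set.inter_eq_left.2 fun p hp => hp.1).symm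

theorem isProjectiveSpaceOfOrder (hC : IsLineConfiguration G D)
    (hall : ∀ l ∈ dLines D, ∀ m ∈ dLines D, l ≠ m → Moves G l m) :
    IsProjectiveSpaceOfOrder (dLines D) (deltaLines D) 4 := by
  rw [hC.deltaLines_eq hall]
  -- a line is determined by any two of its points
  have hline : ∀ {l m x y : Submodule (ZMod 2) V}, l ∈ dLines D → m ∈ dLines D → l ≠ m →
      x ∈ {p ∈ dLines D | p ≤ l ⊔ m} → y ∈ {p ∈ dLines D | p ≤ l ⊔ m} → x ≠ y →
      x ⊔ y = l ⊔ m := fun hl hm hlm hx hy hxy =>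
    hC.sup_eq_sup hl hm hx.1 hy.1 hlm hxy hx.2 hy.2
  refine ⟨?_, ?_, ?_, ?_⟩
  · rintro _ ⟨l, hl, m, hm, hlm, rfl⟩ p hp
    exact hp.1
  · rintro _ ⟨l, hl, m, hm, hlm, rfl⟩
    exact (hC.isSpreadOf_sup hall hl hm hlm).ncard_eq_five
  · intro p hp q hq hpq
    refine ⟨_, ⟨⟨p, hp, q, hq, hpq, rfl⟩, ⟨hp, le_sup_left⟩, hq, le_sup_right⟩, ?_⟩
    rintro _ ⟨⟨l, hl, m, hm, hlm, rfl⟩, hpb, hqb⟩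
    rw [hline hl hm hlm hpb hqb hpq]
  · rintro p hp _ ⟨l₁, hl₁, m₁, hm₁, hlm₁, rfl⟩ _ ⟨l₂, hl₂, m₂, hm₂, hlm₂, rfl⟩ hne hp₁ hp₂
      _ ⟨l₃, hl₃, m₃, hm₃, hlm₃, rfl⟩ _ ⟨l₄, hl₄, m₄, hm₄, hlm₄, rfl⟩
      ⟨x, ⟨hx₃, hx₁⟩, hxp⟩ ⟨y, ⟨hy₃, hy₂⟩, hyp⟩ ⟨z, ⟨hz₄, hz₁⟩, hzp⟩ ⟨w, ⟨hw₄, hw₂⟩, hwp⟩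
    have hxy : x ≠ y := by
      rintro rfl
      apply hne
      rw [← hline hl₁ hm₁ hlm₁ hx₁ hp₁ hxp, ← hline hl₂ hm₂ hlm₂ hy₂ hp₂ hxp]
    have hzw : z ≠ w := by
      rintro rfl
      apply hne
      rw [← hline hl₁ hm₁ hlm₁ hz₁ hp₁ hzp, ← hline hl₂ hm₂ hlm₂ hw₂ hp₂ hzp]
    have e₁ := hline hl₁ hm₁ hlm₁ hx₁ hp₁ hxp
    have e₂ := hline hl₂ hm₂ hlm₂ hy₂ hp₂ hyp
    have e₃ := hline hl₃ hm₃ hlm₃ hx₃ hy₃ hxy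
    have e₄ := hline hl₄ hm₄ hlm₄ hz₄ hw₄ hzw
    have hp' := hC.finiteDimensional_dLine hp
    have hx' := hC.finiteDimensional_dLine hx₁.1
    have hy' := hC.finiteDimensional_dLine hy₂.1
    have hz' := hC.finiteDimensional_dLine hz₁.1
    have hw' := hC.finiteDimensional_dLine hw₂.1
    have hle : (x ⊔ y) ⊔ (z ⊔ w) ≤ x ⊔ y ⊔ p := by
      refine sup_le le_sup_left (sup_le ?_ ?_)
      · exact (e₁ ▸ hz₁.2).trans (sup_le (le_sup_left.trans le_sup_left) le_sup_right)
      · exact (e₂ ▸ hw₂.2).trans (sup_le (le_sup_right.trans le_sup_left) le_sup_right)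
    -- Both four-spaces lie in a space of dimension at most `4 + 2`, so they meet nontrivially; the
    -- `D`-lines through a common nonzero vector within each of them coincide.
    have hdim : Module.finrank (ZMod 2) ↥(x ⊔ y ⊔ p) ≤ 6 := by
      have := Submodule.finrank_sup_add_finrank_inf_eq (x ⊔ y) p
      rw [hC.finrank_sup hx₁.1 hy₂.1 hxy, hC.finrank_dLine hp] at this
      omega
    have hdim' := (Submodule.finrank_mono hle).trans hdim
    have hsum := Submodule.finrank_sup_add_finrank_inf_eq (x ⊔ y) (z ⊔ w)
    rw [hC.finrank_sup hx₁.1 hy₂.1 hxy, hC.finrank_sup hz₁.1 hw₂.1 hzw] at hsum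
    have hinf : (x ⊔ y) ⊓ (z ⊔ w) ≠ ⊥ := by
      intro h
      rw [h, finrank_bot] at hsum
      omega
    obtain ⟨v, ⟨hv₁, hv₂⟩, hv0⟩ := (Submodule.ne_bot_iff _).1 hinf
    obtain ⟨a, ha, hale, hva⟩ := hC.isFull_of_forall_moves hall hx₁.1 hy₂.1 v hv₁
    obtain ⟨b, hb, hble, hvb⟩ := hC.isFull_of_forall_moves hall hz₁.1 hw₂.1 v hv₂
    have hab := hC.eq_of_mem_of_mem ha hb hv0 hva hvb
    exact ⟨a, ⟨ha, e₃ ▸ hale⟩, ha, e₄ ▸ hab ▸ hble⟩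

end IsLineConfiguration

/-! ### The field of order four -/

section FieldOfOrderFour

/-- An endomorphism `J` with `J ^ 2 = J + 1` is the image of a generator of the field with four
elements. -/
theorem exists_algHom_apply_eq {A : Type*} [Ring A] [Algebra (ZMod 2) A] {J : A}
    (hJ : J ^ 2 + J + 1 = 0) :
    ∃ ω : F4, ω ^ 2 + ω + 1 = 0 ∧ ∃ ρ : F4 →ₐ[ZMod 2] A, ρ ω = J := by
  classical
  have : Finite F4 := inferInstance
  let := Fintype.ofFinite F4
  let pb := Field.powerBasisOfFiniteOfSeparable (ZMod 2) F4
  have hdim : pb.dim = 2 := by rw [← pb.finrank, GaloisField.finrank 2 (by norm_num)]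
  have hdeg : (minpoly (ZMod 2) pb.gen).natDegree = 2 := by rw [pb.natDegree_minpoly, hdim]
  have hcard : Fintype.card F4 = 4 := by
    rw [← Nat.card_eq_fintype_card, GaloisField.card 2 2 (by norm_num)]
    norm_num
  have hne : ∀ a : ZMod 2, pb.gen ≠ algebraMap _ _ a := by
    intro a ha
    rw [ha, minpoly.eq_X_sub_C, Polynomial.natDegree_X_sub_C] at hdeg
    norm_num at hdeg
  -- The identity `x⁴ = x` factors as `x (x - 1) (x² + x + 1) = 0`.
  have hω : pb.gen ^ 2 + pb.gen + 1 = 0 := by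
    have h4 := FiniteField.pow_card pb.gen
    rw [hcard] at h4
    have h0 : pb.gen ≠ 0 := by simpa using hne 0
    have h1 : pb.gen - 1 ≠ 0 := sub_ne_zero.2 (by simpa using hne 1)
    refine (mul_eq_zero.1 ((mul_eq_zero.1 ?_).resolve_left h0)).resolve_left h1
    linear_combination h4
  have hmin : minpoly (ZMod 2) pb.gen = Polynomial.X ^ 2 + Polynomial.X + 1 := by
    have hp : (Polynomial.X ^ 2 + Polynomial.X + 1 : Polynomial (ZMod 2)).natDegree = 2 := by
      compute_degree!
    refine (Polynomial.eq_of_monic_of_dvd_of_natDegree_le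
      (minpoly.monic pb.isIntegral_gen) ?_ (minpoly.dvd _ _ ?_) ?_).symm
    · monicity!
    · simpa using hω
    · rw [hp, hdeg]
  refine ⟨pb.gen, hω, pb.lift J ?_, pb.lift_gen _ _⟩
  rw [hmin]
  simpa using hJ

theorem F4.eq_or_eq {ω : F4} (hω : ω ^ 2 + ω + 1 = 0) (c : F4) :
    c = 0 ∨ c = 1 ∨ c = ω ∨ c = 1 + ω := by
  by_cases hc : c = 0
  · exact Or.inl hc
  refine Or.inr ?_
  have h0 : ω ≠ 0 := by rintro rfl; simp at hω
  have h2 : (2 : F4) = 0 := CharTwo.two_eq_zero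
  have h1 : (1 : F4) ≠ ω := by
    rintro rfl
    have : (1 : F4) = 0 := by linear_combination hω - h2
    exact one_ne_zero this
  refine IsLineConfiguration.eq_or_eq_or_eq_add (l := (⊤ : Submodule (ZMod 2) F4)) ?_
    Submodule.mem_top Submodule.mem_top Submodule.mem_top one_ne_zero h0 h1 hc
  rw [finrank_top, GaloisField.finrank 2 (by norm_num)]

end FieldOfOrderFour

/-! ### The vector space structure over the field of order four -/

namespace IsLineConfiguration

variable {V : Type*} [AddCommGroup V] [Module (ZMod 2) V]
  {G : Subgroup (V ≃ₗ[ZMod 2] V)} {D : Set (V ≃ₗ[ZMod 2] V)}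
  {k l m p q x y U : Submodule (ZMod 2) V} {d e f g h t : V ≃ₗ[ZMod 2] V}

theorem mul_mem_transvections {s : V ≃ₗ[ZMod 2] V} (hs : s ∈ transvections G l)
    (ht : t ∈ transvections G l) :
    s * t ∈ transvections G l ∧ ∀ v, (s * t) v - v = (s v - v) + (t v - v) := by
  have key : ∀ v, (s * t) v - v = (s v - v) + (t v - v) := by
    intro v
    have h := mem_fixSpace.1 (hs.2.2 (ht.2.1 v))
    rw [map_sub] at h
    change s (t v) - v = _
    linear_combination (norm := module) h
  refine ⟨⟨G.mul_mem hs.1 ht.1, fun v => ?_, fun v hv => ?_⟩, key⟩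
  · rw [key]
    exact l.add_mem (hs.2.1 v) (ht.2.1 v)
  · rw [mem_fixSpace, ← sub_eq_zero, key, mem_fixSpace.1 (hs.2.2 hv),
      mem_fixSpace.1 (ht.2.2 hv)]
    simp

theorem isAxial_transvection_mul (hC : IsLineConfiguration G D) (hd : d ∈ centeredAt D l)
    (ht : t ∈ transvections G l) :
    IsAxial G l (t * d) ∧ ∀ v, (t * d) v - v = (t v - v) + (d v - v) := by
  have key : ∀ v, (t * d) v - v = (t v - v) + (d v - v) := by
    intro v
    have h := mem_fixSpace.1 (ht.2.2 (sub_mem_of_mem hd v))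
    rw [map_sub] at h
    change t (d v) - v = _
    linear_combination (norm := module) h
  refine ⟨⟨G.mul_mem ht.1 (hC.mem_group hd), fun v => ?_, Or.inr fun v hv h => ?_⟩, key⟩
  · rw [key]
    exact l.add_mem (ht.2.1 v) (sub_mem_of_mem hd v)
  · have h1 := key v
    rw [h, mem_fixSpace.1 (ht.2.2 hv), sub_self, zero_add, eq_comm, sub_eq_zero] at h1
    exact hC.eq_zero_of_apply_eq hd hv h1

theorem isAxial_transvection_mul_sq (hC : IsLineConfiguration G D) (hd : d ∈ centeredAt D l)
    (ht : t ∈ transvections G l) :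
    IsAxial G l (t * (d * d)) ∧
      ∀ v, (t * (d * d)) v - v = (t v - v) + (d (d v) - v) := by
  have hmem : ∀ v, d (d v) - v ∈ l := by
    intro v
    have := l.add_mem (sub_mem_of_mem hd (d v)) (sub_mem_of_mem hd v)
    rwa [sub_add_sub_cancel] at this
  have key : ∀ v, (t * (d * d)) v - v = (t v - v) + (d (d v) - v) := by
    intro v
    have h := mem_fixSpace.1 (ht.2.2 (hmem v))
    rw [map_sub] at h
    change t (d (d v)) - v = _
    linear_combination (norm := module) h
  have hdG := hC.mem_group hd
  refine ⟨⟨G.mul_mem ht.1 (G.mul_mem hdG hdG), fun v => ?_, Or.inr fun v hv h => ?_⟩, key⟩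
  · rw [key]
    exact l.add_mem (ht.2.1 v) (hmem v)
  · have h1 := key v
    rw [h, mem_fixSpace.1 (ht.2.2 hv), sub_self, zero_add, eq_comm, sub_eq_zero] at h1
    refine hC.eq_zero_of_apply_eq hd hv ?_
    nth_rw 1 [← h1]
    exact hC.cube_apply hd v

/-- The maps `(t - 1) + a (d - 1) + b (d² - 1)`, where `t` is a transvection with the center of
`d`. -/
def axialSpan (G : Subgroup (V ≃ₗ[ZMod 2] V)) (l : Submodule (ZMod 2) V)
    (d : V ≃ₗ[ZMod 2] V) : Set (V → V) :=
  {ψ | ∃ t ∈ transvections G l, ∃ a b : ZMod 2,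
    ∀ v, ψ v = (t v - v) + a • (d v - v) + b • (d (d v) - v)}

theorem axialSpan_add {ψ₁ ψ₂ : V → V} (hψ : ψ₁ ∈ axialSpan G l d) (hφ : ψ₂ ∈ axialSpan G l d) :
    ψ₁ + ψ₂ ∈ axialSpan G l d := by
  obtain ⟨s, hs, a, b, hs'⟩ := hψ
  obtain ⟨t, ht, a', b', ht'⟩ := hφ
  obtain ⟨hst, hst'⟩ := mul_mem_transvections hs ht
  refine ⟨s * t, hst, a + a', b + b', fun v => ?_⟩
  rw [Pi.add_apply, hs', ht', hst']
  module

/-- Applying `d` turns `d - 1` into `d² - d = (d - 1) + (d² - 1)` and `d² - 1` into `1 - d = d - 1`,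
by characteristic two and `d³ = 1`. This gives the new coefficients `a + b` and `a`. -/
theorem axialSpan_apply (hC : IsLineConfiguration G D) (hd : d ∈ centeredAt D l)
    {ψ : V → V} (hψ : ψ ∈ axialSpan G l d) : (fun v => d (ψ v)) ∈ axialSpan G l d := by
  obtain ⟨t, ht, a, b, h⟩ := hψ
  obtain ⟨s, hs, hs'⟩ := hC.exists_transvection_smul hd ht
  refine ⟨s, hs, a + b, a, fun v => ?_⟩
  have h1 := ZModModule.add_self (a • (d v))
  have h2 := ZModModule.add_self (a • v)
  have h3 := ZModModule.add_self (b • (d v))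
  have h4 := ZModModule.add_self (b • v)
  simp only [h, map_add, map_smul, hs', map_sub, hC.cube_apply hd]
  linear_combination (norm := module) h2 - h1 + h4 - h3

theorem axialSpan_mem (hd : d ∈ centeredAt D l) {ψ : V → V} (hψ : ψ ∈ axialSpan G l d) (v : V) :
    ψ v ∈ l := by
  obtain ⟨t, ht, a, b, h⟩ := hψ
  rw [h]
  refine l.add_mem (l.add_mem (ht.2.1 v) (l.smul_mem _ (sub_mem_of_mem hd v)))
    (l.smul_mem _ ?_)
  have := l.add_mem (sub_mem_of_mem hd (d v)) (sub_mem_of_mem hd v)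
  rwa [sub_add_sub_cancel] at this

theorem axialSpan_map_sub {ψ : V → V} (hψ : ψ ∈ axialSpan G l d) (v w : V) :
    ψ (v - w) = ψ v - ψ w := by
  obtain ⟨t, ht, a, b, h⟩ := hψ
  simp only [h, map_sub]
  module

/-- Up to applying `d`, each map in the span is `g - 1` for an axial `g` with center `l`, so the
rigidity of axial elements applies. Only `a = b = 1` needs the extra factor: then `d ∘ ψ` has
coefficients `0` and `1`. -/
theorem axialSpan_eq_zero (hC : IsLineConfiguration G D) (hd : d ∈ centeredAt D l)
    {ψ : V → V} (hψ : ψ ∈ axialSpan G l d) (hm : m ∈ dLines D) {v w : V} (hv : v ∈ m)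
    (hv0 : v ≠ 0) (hψv : ψ v = 0) (hw : w ∈ m) : ψ w = 0 := by
  have hl := mem_dLines_of_mem hd
  have key : ∀ g, IsAxial G l g → g v - v = 0 → g w - w = 0 := by
    intro g hg h
    exact sub_eq_zero.2 (mem_fixSpace.1
      (hC.le_fixSpace_of_apply_eq hg hl hm hv hv0 (sub_eq_zero.1 h) hw))
  have hcase : ∀ a : ZMod 2, a = 0 ∨ a = 1 := by decide
  have hψ' := hC.axialSpan_apply hd hψ
  obtain ⟨t, ht, a, b, h⟩ := hψ
  rcases hcase a with rfl | rfl <;> rcases hcase b with rfl | rfl <;>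
    simp only [zero_smul, one_smul, add_zero] at h
  · rw [h] at hψv ⊢
    exact key t (isAxial_of_transvections ht) hψv
  · obtain ⟨h1, h2⟩ := hC.isAxial_transvection_mul_sq hd ht
    rw [h, ← h2] at hψv ⊢
    exact key _ h1 hψv
  · obtain ⟨h1, h2⟩ := hC.isAxial_transvection_mul hd ht
    rw [h, ← h2] at hψv ⊢
    exact key _ h1 hψv
  · obtain ⟨s, hs, hs'⟩ := hC.exists_transvection_smul hd ht
    obtain ⟨h1, h2⟩ := hC.isAxial_transvection_mul_sq hd hs
    have h3 : ∀ u, d (ψ u) = (s * (d * d)) u - u := by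
      intro u
      have h4 := ZModModule.add_self (d u)
      rw [h2, h, hs']
      simp only [map_add, map_sub, hC.cube_apply hd]
      have h5 := ZModModule.add_self u
      linear_combination (norm := module) h5 - h4
    have h4 : d (ψ v) = 0 := by rw [hψv, map_zero]
    rw [h3] at h4
    have h5 := key _ h1 h4
    rw [← h3] at h5
    simpa using h5

/-- A linear operator preserving all `D`-lines and satisfying `J ^ 2 = J + 1`. -/
theorem exists_endomorphism (hC : IsLineConfiguration G D)
    (hall : ∀ l ∈ dLines D, ∀ m ∈ dLines D, l ≠ m → Moves G l m)
    (hcov : ∀ v : V, ∃ l ∈ dLines D, v ∈ l) :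
    ∃ J : V →ₗ[ZMod 2] V, (∀ v, J (J v) = J v + v) ∧ ∀ m ∈ dLines D, ∀ v ∈ m, J v ∈ m := by
  obtain ⟨l, hl, -⟩ := hcov 0
  obtain ⟨d, hd⟩ := exists_mem_centeredAt hl
  have hinj : ∀ m ∈ dLines D, ∃ ψ ∈ axialSpan G l d, (∀ v ∈ m, ψ v = 0 → v = 0) ∧
      ∀ x ∈ l, ∃ v ∈ m, ψ v = x := by
    intro m hm
    obtain ⟨g, hg, hgm, hgψ⟩ : ∃ g, IsAxial G l g ∧ ¬ m ≤ fixSpace g ∧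
        (fun v => g v - v) ∈ axialSpan G l d := by
      by_cases hlm : l = m
      · subst hlm
        exact ⟨d, hC.isAxial_of_centeredAt hd, hC.not_le_fixSpace hd, 1, one_mem_transvections,
          1, 0, fun v => by simp⟩
      · obtain ⟨t, ht, htm⟩ := hall l hl m hm hlm
        exact ⟨t, isAxial_of_transvections ht, htm, t, ht, 0, 0, fun v => by simp⟩
    refine ⟨_, hgψ, fun v hv h => ?_, fun x hx => hC.exists_sub_eq hg hl hm hgm hx⟩
    by_contra h0
    exact hC.apply_ne hg hl hm hgm hv h0 (sub_eq_zero.1 h)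
  have huniq : ∀ v w : V, (∀ ψ ∈ axialSpan G l d, ψ v = ψ w) → v = w := by
    intro v w h
    obtain ⟨m, hm, hvw⟩ := hcov (v - w)
    obtain ⟨ψ, hψ, hinj, -⟩ := hinj m hm
    exact sub_eq_zero.1 (hinj _ hvw (by rw [axialSpan_map_sub hψ, h ψ hψ, sub_self]))
  -- The vector `w`, which becomes `J v`, is found on a `D`-line through `v` using one `ψ` bijective
  -- from that line to `l`. Any other `φ` agrees there with `0`, `ψ`, `d ψ` or `d² ψ`, so the same
  -- `w` works for it.
  have hex : ∀ v : V, ∃ w, (∀ ψ ∈ axialSpan G l d, ψ w = d (ψ v)) ∧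
      ∀ m ∈ dLines D, v ∈ m → w ∈ m := by
    intro v
    have hzero : ∀ ψ ∈ axialSpan G l d, ψ 0 = 0 := by
      intro ψ hψ
      have := axialSpan_map_sub hψ 0 0
      simpa using this
    by_cases hv0 : v = 0
    · subst hv0
      exact ⟨0, fun ψ hψ => by rw [hzero ψ hψ, map_zero], fun m _ _ => m.zero_mem⟩
    obtain ⟨m, hm, hv⟩ := hcov v
    obtain ⟨ψ, hψ, hψinj, hψsurj⟩ := hinj m hm
    obtain ⟨w, hw, hψw⟩ := hψsurj _ (apply_mem hd (axialSpan_mem hd hψ v))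
    refine ⟨w, fun φ hφ => ?_, fun m' hm' hv' => ?_⟩
    · -- `φ` agrees on `m` with a multiple of `ψ`
      have hmul : ∀ χ ∈ axialSpan G l d, φ v = χ v → χ w = d (χ v) → φ w = d (φ v) := by
        intro χ hχ hv' hw'
        have h1 := hC.axialSpan_eq_zero hd (axialSpan_add hφ hχ) hm hv hv0
          (by rw [Pi.add_apply, hv', ZModModule.add_self]) hw
        rw [Pi.add_apply, ← ZModModule.sub_eq_add, sub_eq_zero] at h1
        rw [h1, hw', hv']
      by_cases hφv : φ v = 0
      · rw [hφv, map_zero]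
        exact hC.axialSpan_eq_zero hd hφ hm hv hv0 hφv hw
      have hdψ := hC.axialSpan_apply hd hψ
      have hddψ := hC.axialSpan_apply hd hdψ
      rcases hC.eq_or_eq_apply hd (axialSpan_mem hd hψ v) (axialSpan_mem hd hφ v)
        (fun h => hv0 (hψinj v hv h)) hφv with h | h | h
      · exact hmul _ hψ h hψw
      · exact hmul _ hdψ h (by rw [hψw])
      · exact hmul _ hddψ h (by rw [hψw])
    · rwa [hC.eq_of_mem_of_mem hm' hm hv0 hv' hv]
  choose J hJ hJm using hex
  have hadd : ∀ ψ ∈ axialSpan G l d, ∀ v w, ψ (v + w) = ψ v + ψ w := by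
    intro ψ hψ v w
    rw [← ZModModule.sub_eq_add, axialSpan_map_sub hψ, ZModModule.sub_eq_add]
  have hsmul : ∀ (c : ZMod 2) v, J (c • v) = c • J v := by
    intro c v
    have hcase : ∀ a : ZMod 2, a = 0 ∨ a = 1 := by decide
    rcases hcase c with rfl | rfl
    · have h0 : J 0 = 0 := huniq _ _ fun ψ hψ => by
        have h := axialSpan_map_sub hψ 0 0
        rw [sub_self, sub_self] at h
        rw [hJ 0 ψ hψ, h, map_zero]
      rw [zero_smul, zero_smul, h0]
    · rw [one_smul, one_smul]
  refine ⟨⟨⟨J, fun v w => ?_⟩, hsmul⟩, fun v => ?_, fun m hm v hv => hJm v m hm hv⟩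
  · refine huniq _ _ fun ψ hψ => ?_
    rw [hJ _ ψ hψ, hadd ψ hψ, hadd ψ hψ, hJ _ ψ hψ, hJ _ ψ hψ, map_add]
  · refine huniq _ _ fun ψ hψ => ?_
    change ψ (J (J v)) = ψ (J v + v)
    rw [hadd ψ hψ, hJ _ ψ hψ, hJ _ ψ hψ, hC.apply_apply_eq hd (axialSpan_mem hd hψ v)]

theorem commute_of_mem (hC : IsLineConfiguration G D)
    (hcov : ∀ v : V, ∃ l ∈ dLines D, v ∈ l) {J : V →ₗ[ZMod 2] V} (hJ : ∀ v, J (J v) = J v + v)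
    (hJm : ∀ m ∈ dLines D, ∀ v ∈ m, J v ∈ m) (hg : g ∈ G) (v : V) : g (J v) = J (g v) := by
  have hJ0 : ∀ v, J v = v → v = 0 := by
    intro v h
    have := hJ v
    rw [h, h] at this
    simpa using this
  -- an element of `G` commutes with `J` or interchanges `J` and `J + 1`
  have hor : ∀ g ∈ G, (∀ v, g (J v) = J (g v)) ∨ ∀ v, g (J v) = J (g v) + g v := by
    intro g hg
    have hpt : ∀ v, g (J v) = J (g v) ∨ g (J v) = J (g v) + g v := by
      intro v
      by_cases hv0 : v = 0
      · left; simp [hv0]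
      obtain ⟨m, hm, hv⟩ := hcov v
      have hgm := hC.act_mem_dLines hg hm
      have hgv := apply_mem_act (g := g) hv
      have h1 : g (J v) ∈ act g m := apply_mem_act (hJm m hm v hv)
      have hgv0 : g v ≠ 0 := by simpa using hv0
      have hJv0 : J v ≠ 0 := by
        intro h
        have := hJ v
        rw [h, map_zero, zero_add] at this
        exact hv0 this.symm
      have hJgv0 : J (g v) ≠ 0 := by
        intro h
        have := hJ (g v)
        rw [h, map_zero, zero_add] at this
        exact hgv0 this.symm
      rcases eq_or_eq_or_eq_add (hC.finrank_dLine hgm) hgv (hJm _ hgm _ hgv) h1 hgv0 hJgv0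
        (fun h => hgv0 (hJ0 _ h.symm)) (by simpa using hJv0) with h | h | h
      · exact absurd (hJ0 v (g.injective h)) hv0
      · exact Or.inl h
      · right; rw [h, add_comm]
    -- The two alternatives are additive conditions on the vector, and a group is not the union of
    -- two proper subgroups.
    by_contra! hcon
    obtain ⟨⟨v, hv⟩, w, hw⟩ := hcon
    have hv' := (hpt v).resolve_left hv
    have hw' := (hpt w).resolve_right hw
    rcases hpt (v + w) with h | h <;> simp only [map_add] at h
    · rw [hw', add_left_inj] at h
      exact hv h
    · rw [hv', hw'] at h
      have h0 : g w = 0 := by linear_combination (norm := module) - h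
      exact hw (by rw [hw', h0, add_zero])
  have hD : ∀ d ∈ D, ∀ v, d (J v) = J (d v) := by
    intro d hd
    rcases hor d (hC.mem_of_mem hd) with h | h
    · exact h
    exfalso
    have hd' : d ∈ centeredAt D (commSpace d) := ⟨hd, rfl⟩
    obtain ⟨v, -, hv0⟩ := hC.exists_ne_zero (mem_dLines_of_mem hd')
    -- Three interchanges of `J` and `J + 1` amount to one, whereas `d³ = 1`.
    have h1 : d (d (d (J v))) = J v + v := by
      simp only [h, map_add, hC.cube_apply hd']
      have := ZModModule.add_self v
      linear_combination (norm := module) this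
    rw [hC.cube_apply hd', left_eq_add] at h1
    exact hv0 h1
  rw [← hC.closure_eq] at hg
  induction hg using Subgroup.closure_induction generalizing v with
  | mem d hd => exact hD d hd v
  | one => rfl
  | mul a b _ _ iha ihb =>
    change a (b (J v)) = J (a (b v))
    rw [ihb, iha]
  | inv a _ ih =>
    have := ih (a⁻¹ v)
    rw [apply_inv_self'] at this
    rw [← this, inv_apply_self']

/-- The structure of a vector space over the field with four elements. -/
theorem exists_module (hC : IsLineConfiguration G D)
    (hall : ∀ l ∈ dLines D, ∀ m ∈ dLines D, l ≠ m → Moves G l m)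
    (hcov : ∀ v : V, ∃ l ∈ dLines D, v ∈ l) :
    ∃ (_ : Module F4 V) (_ : IsScalarTower (ZMod 2) F4 V),
      (∀ l ∈ dLines D, ∀ c : F4, ∀ v ∈ l, c • v ∈ l) ∧
      ∀ g ∈ G, ∀ (c : F4) (v : V), g (c • v) = c • g v := by
  obtain ⟨J, hJ, hJm⟩ := hC.exists_endomorphism hall hcov
  obtain ⟨ω, hω, ρ, hρ⟩ := exists_algHom_apply_eq (A := Module.End (ZMod 2) V) (J := J) (by
    ext v
    have h1 := ZModModule.add_self (J v)
    have h2 := ZModModule.add_self v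
    simp only [LinearMap.add_apply, pow_two, Module.End.mul_apply, hJ, Module.End.one_apply,
      LinearMap.zero_apply]
    linear_combination (norm := module) h1 + h2)
  let M : Module F4 V := Module.compHom V ρ.toRingHom
  refine ⟨M, ⟨fun a c v => ?_⟩, fun l hl c v hv => ?_,
    fun g hg c v => ?_⟩
  · change ρ (a • c) v = a • ρ c v
    rw [map_smul, LinearMap.smul_apply]
  · change ρ c v ∈ l
    rcases F4.eq_or_eq hω c with rfl | rfl | rfl | rfl
    · simp
    · simpa using hv
    · rw [hρ]
      exact hJm l hl v hv
    · rw [map_add, map_one, hρ]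
      exact l.add_mem hv (hJm l hl v hv)
  · change g (ρ c v) = ρ c (g v)
    have := hC.commute_of_mem hcov hJ hJm hg v
    rcases F4.eq_or_eq hω c with rfl | rfl | rfl | rfl
    · simp
    · simp
    · rw [hρ, this]
    · rw [map_add, map_one, hρ]
      simp [this]

end IsLineConfiguration

/-! ### Arithmetic of the field of order four and restriction of scalars -/

theorem F4.sq_add_add {c : F4} (h0 : c ≠ 0) (h1 : c ≠ 1) : c ^ 2 + c + 1 = 0 := by
  classical
  let := Fintype.ofFinite F4
  have hcard : Fintype.card F4 = 4 := by
    rw [← Nat.card_eq_fintype_card, GaloisField.card 2 2 (by norm_num)]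
    norm_num
  have h4 := FiniteField.pow_card c
  rw [hcard] at h4
  refine (mul_eq_zero.1 ((mul_eq_zero.1 ?_).resolve_left h0)).resolve_left (sub_ne_zero.2 h1)
  linear_combination h4

theorem F4.eq_or_eq_mul_self {c b : F4} (hc0 : c ≠ 0) (hc1 : c ≠ 1) (h0 : b ≠ 0) (h1 : b ≠ 1) :
    b = c ∨ b = c * c := by
  have h := F4.sq_add_add hc0 hc1
  have h2 : (2 : F4) = 0 := CharTwo.two_eq_zero
  rcases F4.eq_or_eq h b with h' | h' | h' | h'
  · exact absurd h' h0
  · exact absurd h' h1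
  · exact Or.inl h'
  · right
    linear_combination h' + (c + 1) * h2 - h

theorem span_singleton_eq_of_finrank_eq_one {K V : Type*} [Field K] [AddCommGroup V]
    [Module K V] {U : Submodule K V}
    (hU : Module.finrank K U = 1) {v : V} (hv : v ∈ U) (hv0 : v ≠ 0) :
    Submodule.span K {v} = U := by
  have : FiniteDimensional K U := Module.finite_of_finrank_pos (by omega)
  exact Submodule.eq_of_le_of_finrank_eq ((Submodule.span_singleton_le_iff_mem _ _).2 hv)
    (by rw [finrank_span_singleton hv0, hU])

section VectorSpace

variable {V : Type*} [AddCommGroup V] [Module (ZMod 2) V] [Module F4 V]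

/-- The map `w ↦ w + φ w • v` belongs to `G`. -/
def Realizes (G : Subgroup (V ≃ₗ[ZMod 2] V)) (v : V) (φ : Module.Dual F4 V) : Prop :=
  ∃ g ∈ G, ∀ w, g w = w + φ w • v

variable [IsScalarTower (ZMod 2) F4 V]

theorem finrank_restrictScalars_eq (U : Submodule F4 V) :
    Module.finrank (ZMod 2) (U.restrictScalars (ZMod 2)) = 2 * Module.finrank F4 U := by
  have h := Module.finrank_mul_finrank (ZMod 2) F4 U
  rw [GaloisField.finrank 2 (by norm_num)] at h
  exact h.symm

/-- A subspace over the prime field closed under scalars. -/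
def ofSmulMem (W : Submodule (ZMod 2) V) (h : ∀ (c : F4), ∀ v ∈ W, c • v ∈ W) :
    Submodule F4 V :=
  { W with smul_mem' := fun c _ hv => h c _ hv }

theorem restrictScalars_ofSmulMem (W : Submodule (ZMod 2) V)
    (h : ∀ (c : F4), ∀ v ∈ W, c • v ∈ W) :
    (ofSmulMem W h).restrictScalars (ZMod 2) = W := rfl

end VectorSpace

/-! ### `D`-lines and lines of `Δ` as subspaces over the field of order four -/

namespace IsLineConfiguration

variable {V : Type*} [AddCommGroup V] [Module (ZMod 2) V] [Module F4 V]
  [IsScalarTower (ZMod 2) F4 V]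
  {G : Subgroup (V ≃ₗ[ZMod 2] V)} {D : Set (V ≃ₗ[ZMod 2] V)}
  {l m : Submodule (ZMod 2) V} {d g : V ≃ₗ[ZMod 2] V}

theorem finrank_ofSmulMem (hC : IsLineConfiguration G D) (hl : l ∈ dLines D)
    (h : ∀ (c : F4), ∀ v ∈ l, c • v ∈ l) : Module.finrank F4 (ofSmulMem l h) = 1 := by
  have h1 := finrank_restrictScalars_eq (ofSmulMem l h)
  rw [restrictScalars_ofSmulMem, hC.finrank_dLine hl] at h1
  omega

theorem span_eq_ofSmulMem (hC : IsLineConfiguration G D) (hl : l ∈ dLines D)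
    (h : ∀ (c : F4), ∀ v ∈ l, c • v ∈ l) {v : V} (hv : v ∈ l) (hv0 : v ≠ 0) :
    Submodule.span F4 {v} = ofSmulMem l h :=
  span_singleton_eq_of_finrank_eq_one (hC.finrank_ofSmulMem hl h) hv hv0

theorem dLines_eq (hC : IsLineConfiguration G D)
    (hcov : ∀ v : V, ∃ l ∈ dLines D, v ∈ l)
    (hsmul : ∀ l ∈ dLines D, ∀ c : F4, ∀ v ∈ l, c • v ∈ l) :
    dLines D = {l | ∃ U : Submodule F4 V, Module.finrank F4 U = 1 ∧
      l = U.restrictScalars (ZMod 2)} := by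
  ext l
  constructor
  · intro hl
    exact ⟨ofSmulMem l (hsmul l hl), hC.finrank_ofSmulMem hl _, rfl⟩
  · rintro ⟨U, hU, rfl⟩
    obtain ⟨v, hv, hv0⟩ : ∃ v ∈ U, v ≠ 0 := by
      refine (Submodule.ne_bot_iff U).1 ?_
      rintro rfl
      simp at hU
    obtain ⟨l, hl, hvl⟩ := hcov v
    rw [← span_singleton_eq_of_finrank_eq_one hU hv hv0,
      hC.span_eq_ofSmulMem hl (hsmul l hl) hvl hv0]
    exact hl

theorem le_restrictScalars (hC : IsLineConfiguration G D)
    (hsmul : ∀ l ∈ dLines D, ∀ c : F4, ∀ v ∈ l, c • v ∈ l) (hl : l ∈ dLines D) {v : V}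
    (hv : v ∈ l) (hv0 : v ≠ 0) {U : Submodule F4 V} (hvU : v ∈ U) :
    l ≤ U.restrictScalars (ZMod 2) := by
  intro w hw
  have h := hC.span_eq_ofSmulMem hl (hsmul l hl) hv hv0
  have hw' : w ∈ Submodule.span F4 {v} := h ▸ hw
  exact (Submodule.span_singleton_le_iff_mem _ _).2 hvU hw'

theorem deltaLines_eq_subspaces (hC : IsLineConfiguration G D)
    (hall : ∀ l ∈ dLines D, ∀ m ∈ dLines D, l ≠ m → Moves G l m)
    (hcov : ∀ v : V, ∃ l ∈ dLines D, v ∈ l)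
    (hsmul : ∀ l ∈ dLines D, ∀ c : F4, ∀ v ∈ l, c • v ∈ l) :
    deltaLines D = {b | ∃ U : Submodule F4 V, Module.finrank F4 U = 2 ∧
      b = {l ∈ dLines D | l ≤ U.restrictScalars (ZMod 2)}} := by
  rw [hC.deltaLines_eq hall]
  ext b
  constructor
  · rintro ⟨l, hl, m, hm, hlm, rfl⟩
    have h : ∀ (c : F4), ∀ v ∈ l ⊔ m, c • v ∈ l ⊔ m := by
      intro c v hv
      obtain ⟨a, ha, b, hb, rfl⟩ := Submodule.mem_sup.1 hv
      rw [smul_add]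
      exact Submodule.add_mem_sup (hsmul l hl c a ha) (hsmul m hm c b hb)
    refine ⟨ofSmulMem (l ⊔ m) h, ?_, rfl⟩
    have h1 := finrank_restrictScalars_eq (ofSmulMem (l ⊔ m) h)
    rw [restrictScalars_ofSmulMem, hC.finrank_sup hl hm hlm] at h1
    omega
  · rintro ⟨U, hU, rfl⟩
    have hfin : FiniteDimensional F4 U := Module.finite_of_finrank_pos (by omega)
    obtain ⟨v, hv, hv0⟩ : ∃ v ∈ U, v ≠ 0 := by
      refine (Submodule.ne_bot_iff U).1 ?_
      rintro rfl
      simp at hU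
    obtain ⟨l, hl, hvl⟩ := hcov v
    obtain ⟨w, hw, hwl⟩ : ∃ w ∈ U, w ∉ l := by
      by_contra! hcon
      have h1 := Submodule.finrank_mono (R := F4) (s := U) (t := Submodule.span F4 {v})
        (by rw [hC.span_eq_ofSmulMem hl (hsmul l hl) hvl hv0]; exact hcon)
      rw [hU, finrank_span_singleton hv0] at h1
      omega
    obtain ⟨m, hm, hwm⟩ := hcov w
    have hlm : l ≠ m := by rintro rfl; exact hwl hwm
    have hw0 : w ≠ 0 := by rintro rfl; exact hwl l.zero_mem
    have hrank : Module.finrank (ZMod 2) (U.restrictScalars (ZMod 2)) = 4 := by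
      rw [finrank_restrictScalars_eq, hU]
    have : FiniteDimensional (ZMod 2) (U.restrictScalars (ZMod 2)) :=
      Module.finite_of_finrank_pos (by omega)
    have hsup : l ⊔ m = U.restrictScalars (ZMod 2) :=
      Submodule.eq_of_le_of_finrank_eq
        (sup_le (hC.le_restrictScalars hsmul hl hvl hv0 hv)
          (hC.le_restrictScalars hsmul hm hwm hw0 hw))
        (by rw [hC.finrank_sup hl hm hlm, hrank])
    exact ⟨l, hl, m, hm, hlm, by rw [hsup]⟩

/-- An element of `G` acting trivially modulo the line of `v` is given by a functional. -/
theorem exists_dual (hC : IsLineConfiguration G D)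
    (hsmul : ∀ l ∈ dLines D, ∀ c : F4, ∀ v ∈ l, c • v ∈ l)
    (hlin : ∀ g ∈ G, ∀ (c : F4) (v : V), g (c • v) = c • g v)
    (hg : g ∈ G) (hl : l ∈ dLines D) (hgl : ∀ w, g w - w ∈ l) {v : V} (hv : v ∈ l)
    (hv0 : v ≠ 0) : ∃ φ : Module.Dual F4 V, ∀ w, g w = w + φ w • v := by
  have hspan := hC.span_eq_ofSmulMem hl (hsmul l hl) hv hv0
  let N : V →ₗ[F4] Submodule.span F4 {v} :=
    { toFun := fun w => ⟨g w - w, by rw [hspan]; exact hgl w⟩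
      map_add' := fun a b => by
        ext
        simp only [map_add, Submodule.coe_add]
        abel
      map_smul' := fun c a => by
        ext
        simp only [hlin g hg, RingHom.id_apply, Submodule.coe_smul, smul_sub] }
  let E := LinearEquiv.toSpanNonzeroSingleton F4 V v hv0
  refine ⟨E.symm.toLinearMap ∘ₗ N, fun w => ?_⟩
  have h : (E (E.symm (N w)) : V) = g w - w := by rw [LinearEquiv.apply_symm_apply]; rfl
  have h' : E.symm (N w) • v = g w - w := by
    rw [← h]
    rfl
  change g w = w + E.symm (N w) • v
  rw [h']
  abel

end IsLineConfiguration

/-- The situation in which the elements of `G` are linear over the field with four elements and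
the `D`-lines are its one-dimensional subspaces, with transvections at each point moving every
other point. -/
structure IsReflectionConfiguration {V : Type*} [AddCommGroup V] [Module (ZMod 2) V] [Module F4 V]
    (G : Subgroup (V ≃ₗ[ZMod 2] V)) : Prop where
  map_smul : ∀ g ∈ G, ∀ (c : F4) (v : V), g (c • v) = c • g v
  exists_reflection : ∀ v : V, v ≠ 0 →
    ∃ δ : Module.Dual F4 V, Realizes G v δ ∧ δ v ≠ 0 ∧ δ v ≠ 1
  exists_transvection : ∀ v u : V, v ≠ 0 → u ∉ Submodule.span F4 {v} →
    ∃ χ : Module.Dual F4 V, Realizes G v χ ∧ χ v = 0 ∧ χ u ≠ 0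

/-! ### Functionals of reflections and transvections -/

namespace IsReflectionConfiguration

variable {V : Type*} [AddCommGroup V] [Module (ZMod 2) V] [Module F4 V]
  {G : Subgroup (V ≃ₗ[ZMod 2] V)} {u v : V} {φ χ δ ε ψ : Module.Dual F4 V}

theorem realizes_zero (v : V) : Realizes G v 0 := ⟨1, G.one_mem, fun w => by simp⟩

theorem realizes_add (hφ : Realizes G v φ)
    (hχ : Realizes G v χ) (h0 : χ v = 0) : Realizes G v (φ + χ) := by
  obtain ⟨g, hg, hg'⟩ := hφ
  obtain ⟨t, ht, ht'⟩ := hχ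
  refine ⟨t * g, G.mul_mem ht hg, fun w => ?_⟩
  change t (g w) = _
  rw [ht', hg', map_add, LinearMap.map_smul, h0]
  simp only [smul_zero, add_zero, LinearMap.add_apply]
  module

theorem realizes_comp (hR : IsReflectionConfiguration G) {g : V ≃ₗ[ZMod 2] V} (hg : g ∈ G)
    (hφ : Realizes G v φ) (h : ∀ w, χ w = φ (g⁻¹ w)) : Realizes G (g v) χ := by
  obtain ⟨t, ht, ht'⟩ := hφ
  refine ⟨g * t * g⁻¹, G.mul_mem (G.mul_mem hg ht) (G.inv_mem hg), fun w => ?_⟩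
  change g (t (g⁻¹ w)) = _
  rw [ht', map_add, hR.map_smul g hg, apply_inv_self', h]

theorem inv_apply {g : V ≃ₗ[ZMod 2] V} (hg' : ∀ w, g w = w + δ w • v) (h1 : δ v ≠ 1) (w : V) :
    g⁻¹ w = w - (δ w * (1 + δ v)⁻¹) • v := by
  have h2 : 1 + δ v ≠ 0 := by
    intro h
    apply h1
    have h2 : (2 : F4) = 0 := CharTwo.two_eq_zero
    linear_combination h - h2
  have : g (w - (δ w * (1 + δ v)⁻¹) • v) = w := by
    rw [hg', map_sub, LinearMap.map_smul, smul_eq_mul]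
    have h3 : δ w - δ w * (1 + δ v)⁻¹ * δ v = δ w * (1 + δ v)⁻¹ := by
      field_simp
      ring
    rw [h3]
    abel
  rw [← this, inv_apply_self', this]

/-- Conjugation by the reflection fixes the functional `χ`, which vanishes at `v`, and multiplies
the center by `1 + δ v`. -/
theorem realizes_mul_smul (hR : IsReflectionConfiguration G) (hδ : Realizes G v δ)
    (h1 : δ v ≠ 1) (hχ : Realizes G v χ) (h0 : χ v = 0) :
    Realizes G v ((1 + δ v) • χ) := by
  obtain ⟨g, hg, hg'⟩ := hδ
  obtain ⟨t, ht, ht'⟩ := hχ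
  refine ⟨g * t * g⁻¹, G.mul_mem (G.mul_mem hg ht) (G.inv_mem hg), fun w => ?_⟩
  change g (t (g⁻¹ w)) = _
  rw [ht', map_add, hR.map_smul g hg, apply_inv_self', inv_apply hg' h1, map_sub,
    LinearMap.map_smul, h0, hg']
  simp only [LinearMap.smul_apply, smul_eq_mul]
  module

/-- The functionals of the transvections in `G` with center `v`. -/
noncomputable def transvectionSubmodule (hR : IsReflectionConfiguration G) (hv : v ≠ 0) :
    Submodule F4 (Module.Dual F4 V) where
  carrier := {χ | Realizes G v χ ∧ χ v = 0}
  zero_mem' := ⟨realizes_zero v, rfl⟩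
  add_mem' := fun ha hb =>
    ⟨realizes_add ha.1 hb.1 hb.2, by rw [LinearMap.add_apply, ha.2, hb.2, add_zero]⟩
  smul_mem' := by
    rintro c χ ⟨hχ, h0⟩
    refine ⟨?_, by rw [LinearMap.smul_apply, h0, smul_zero]⟩
    obtain ⟨δ, hδ, hδ0, hδ1⟩ := hR.exists_reflection v hv
    have hδχ := hR.realizes_mul_smul hδ hδ1 hχ h0
    have h2 : (2 : F4) = 0 := CharTwo.two_eq_zero
    -- The scalars are `0`, `1`, `δ v` and `1 + δ v`; the last comes from conjugation, and `δ v` is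
    -- its sum with `1`.
    rcases F4.eq_or_eq (F4.sq_add_add hδ0 hδ1) c with rfl | rfl | rfl | rfl
    · rw [zero_smul]; exact realizes_zero v
    · rwa [one_smul]
    · have := realizes_add hδχ hχ h0
      have heq : (1 + δ v) • χ + χ = δ v • χ := by
        have : (2 : F4) • χ = 0 := by rw [h2, zero_smul]
        linear_combination (norm := module) this
      rwa [heq] at this
    · exact hδχ

theorem mem_transvectionSubmodule (hR : IsReflectionConfiguration G) (hv : v ≠ 0) :
    χ ∈ hR.transvectionSubmodule hv ↔ Realizes G v χ ∧ χ v = 0 := Iff.rfl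

/-- The square of the reflection has functional `2 δ + δ(v) δ`, and `2 = 0`. -/
theorem realizes_smul_self (hδ : Realizes G v δ) : Realizes G v (δ v • δ) := by
  obtain ⟨g, hg, hg'⟩ := hδ
  refine ⟨g * g, G.mul_mem hg hg, fun w => ?_⟩
  change g (g w) = _
  have h2 : (2 : F4) = 0 := CharTwo.two_eq_zero
  have : (2 : F4) • (δ w • v) = 0 := by rw [h2, zero_smul]
  rw [hg', hg', map_add, LinearMap.map_smul]
  simp only [LinearMap.smul_apply, smul_eq_mul]
  linear_combination (norm := module) this

/-- If `g` and `f` realize `δ` and `ε`, then `g⁻¹ f` is a transvection whose functional is a nonzero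
multiple of `ε - δ`. -/
theorem sub_mem_of_apply_eq (hR : IsReflectionConfiguration G) (hv : v ≠ 0)
    (hδ : Realizes G v δ) (hε : Realizes G v ε) (h1 : δ v ≠ 1) (h : ε v = δ v) :
    ε - δ ∈ hR.transvectionSubmodule hv := by
  have hne : (1 + δ v)⁻¹ ≠ 0 := by
    refine inv_ne_zero fun h' => h1 ?_
    have h2 : (2 : F4) = 0 := CharTwo.two_eq_zero
    linear_combination h' - h2
  refine (Submodule.smul_mem_iff _ hne).1 ?_
  refine (hR.mem_transvectionSubmodule hv).2 ⟨?_, by simp [h]⟩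
  obtain ⟨g, hg, hg'⟩ := hδ
  obtain ⟨f, hf, hf'⟩ := hε
  refine ⟨g⁻¹ * f, G.mul_mem (G.inv_mem hg) hf, fun w => ?_⟩
  change g⁻¹ (f w) = _
  rw [inv_apply hg' h1, hf', map_add, LinearMap.map_smul]
  have hne' : 1 + δ v ≠ 0 := by simpa using hne
  have h3 : ε w - (δ w + ε w * δ v) * (1 + δ v)⁻¹ = (1 + δ v)⁻¹ * (ε w - δ w) := by
    field_simp
    ring
  simp only [LinearMap.smul_apply, LinearMap.sub_apply, smul_eq_mul]
  rw [← h3]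
  module

/-- The functionals of the reflections and transvections in `G` with center `v`. -/
noncomputable def dualSubmodule (hR : IsReflectionConfiguration G) (hv : v ≠ 0) (δ : Module.Dual F4 V) :
    Submodule F4 (Module.Dual F4 V) :=
  hR.transvectionSubmodule hv ⊔ Submodule.span F4 {δ}

theorem mem_dualSubmodule (hR : IsReflectionConfiguration G) (hv : v ≠ 0)
    (hδ : Realizes G v δ) (h0 : δ v ≠ 0) (h1 : δ v ≠ 1) (hε : Realizes G v ε) (hε0 : ε v ≠ 0)
    (hε1 : ε v ≠ 1) : ε ∈ hR.dualSubmodule hv δ := by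
  have hδmem : δ ∈ hR.dualSubmodule hv δ :=
    Submodule.mem_sup_right (Submodule.mem_span_singleton_self δ)
  rcases F4.eq_or_eq_mul_self h0 h1 hε0 hε1 with h | h
  · have := add_mem (Submodule.mem_sup_left (hR.sub_mem_of_apply_eq hv hδ hε h1 h)) hδmem
    rwa [sub_add_cancel] at this
  · have h' : ε v = (δ v • δ) v := h
    have := add_mem (Submodule.mem_sup_left
      (hR.sub_mem_of_apply_eq hv (realizes_smul_self hδ) hε (h' ▸ hε1) h'))
      (Submodule.smul_mem _ (δ v) hδmem)
    rwa [sub_add_cancel] at this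

theorem realizes_of_mem_dualSubmodule (hR : IsReflectionConfiguration G) (hv : v ≠ 0)
    (hδ : Realizes G v δ) (h0 : δ v ≠ 0) (h1 : δ v ≠ 1) (hφ : φ ∈ hR.dualSubmodule hv δ)
    (hφ0 : φ v ≠ 0) (hφ1 : φ v ≠ 1) : Realizes G v φ := by
  obtain ⟨χ, hχ, _, hψ, rfl⟩ := Submodule.mem_sup.1 hφ
  obtain ⟨a, rfl⟩ := Submodule.mem_span_singleton.1 hψ
  rw [hR.mem_transvectionSubmodule hv] at hχ
  rw [add_comm]
  refine realizes_add ?_ hχ.1 hχ.2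
  rw [LinearMap.add_apply, hχ.2, zero_add, LinearMap.smul_apply, smul_eq_mul] at hφ0 hφ1
  rcases F4.eq_or_eq_mul_self h0 h1 hφ0 hφ1 with h | h
  · have : a = 1 := mul_right_cancel₀ h0 (by rw [h, one_mul])
    rwa [this, one_smul]
  · have : a = δ v := mul_right_cancel₀ h0 h
    rw [this]
    exact realizes_smul_self hδ

theorem realizes_smul_left {c : F4} : Realizes G (c • v) φ ↔ Realizes G v (c • φ) := by
  simp only [Realizes, LinearMap.smul_apply, smul_eq_mul, smul_smul, mul_comm c]

theorem dualSubmodule_le_smul (hR : IsReflectionConfiguration G) (hv : v ≠ 0)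
    (hδ : Realizes G v δ) (h0 : δ v ≠ 0) (h1 : δ v ≠ 1) {c : F4} (hc : c ≠ 0)
    (hcv : c • v ≠ 0) (hε : Realizes G (c • v) ε) (hε0 : ε (c • v) ≠ 0)
    (hε1 : ε (c • v) ≠ 1) : hR.dualSubmodule hcv ε ≤ hR.dualSubmodule hv δ := by
  refine sup_le (fun χ hχ => ?_) ((Submodule.span_singleton_le_iff_mem _ _).2 ?_)
  · rw [hR.mem_transvectionSubmodule hcv, realizes_smul_left] at hχ
    refine Submodule.mem_sup_left ((Submodule.smul_mem_iff _ hc).1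
      ((hR.mem_transvectionSubmodule hv).2 ⟨hχ.1, ?_⟩))
    have := hχ.2
    rwa [LinearMap.map_smul] at this
  · rw [realizes_smul_left] at hε
    rw [LinearMap.map_smul] at hε0 hε1
    exact (Submodule.smul_mem_iff _ hc).1 (hR.mem_dualSubmodule hv hδ h0 h1 hε hε0 hε1)

/-- A transvection with center `v` fixing `u` has the functional of a transvection with center
`u`. -/
theorem realizes_of_apply_eq_zero (hR : IsReflectionConfiguration G)
    (hχ : Realizes G v χ) (hχv : χ v = 0) (hχu : χ u = 0) (hψ : Realizes G u ψ)
    (hψu : ψ u = 0) (hψv : ψ v = 1) : Realizes G u χ := by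
  obtain ⟨s, hs, hs'⟩ := id hψ
  -- Conjugation by `s` gives `χ` the center `v + u`; multiplying by the transvection at `v` leaves
  -- the center `v + (v + u) = u`.
  have hsv : s v = v + u := by rw [hs', hψv, one_smul]
  have h1 : Realizes G (s v) χ := by
    refine hR.realizes_comp hs hχ fun w => ?_
    rw [inv_apply hs' (by rw [hψu]; exact zero_ne_one), map_sub, LinearMap.map_smul, hχu,
      smul_zero, sub_zero]
  rw [hsv] at h1
  obtain ⟨t, ht, ht'⟩ := hχ
  obtain ⟨r, hr, hr'⟩ := h1
  refine ⟨r * t, G.mul_mem hr ht, fun w => ?_⟩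
  change r (t w) = _
  have h2 : (2 : F4) = 0 := CharTwo.two_eq_zero
  have : (2 : F4) • (χ w • v) = 0 := by rw [h2, zero_smul]
  rw [hr', ht', map_add, LinearMap.map_smul, hχv]
  simp only [smul_zero, add_zero]
  linear_combination (norm := module) this

/-- Some reflection with center `v` fixes `u`, and its functional belongs to a transvection with
center `u`. -/
theorem exists_reflection_mem (hR : IsReflectionConfiguration G) (hv : v ≠ 0) (hu : u ≠ 0)
    (hvu : u ∉ Submodule.span F4 {v}) (huv : v ∉ Submodule.span F4 {u}) :
    ∃ δ, Realizes G v δ ∧ δ v ≠ 0 ∧ δ v ≠ 1 ∧ δ u = 0 ∧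
      δ ∈ hR.transvectionSubmodule hu := by
  obtain ⟨δ, hδ, h0, h1⟩ := hR.exists_reflection v hv
  obtain ⟨χ, hχ, hχv, hχu⟩ := hR.exists_transvection v u hv hvu
  obtain ⟨ψ, hψ, hψu, hψv⟩ := hR.exists_transvection u v hu huv
  have hχ' : (δ u * (χ u)⁻¹) • χ ∈ hR.transvectionSubmodule hv :=
    Submodule.smul_mem _ _ ((hR.mem_transvectionSubmodule hv).2 ⟨hχ, hχv⟩)
  obtain ⟨δ', hδ'⟩ : ∃ δ', δ' = δ - (δ u * (χ u)⁻¹) • χ := ⟨_, rfl⟩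
  have hδ'R : Realizes G v δ' := by
    rw [hδ', sub_eq_add_neg]
    have := (hR.mem_transvectionSubmodule hv).1 (neg_mem hχ')
    exact realizes_add hδ this.1 this.2
  have hδ'v : δ' v = δ v := by
    rw [hδ', LinearMap.sub_apply, LinearMap.smul_apply, hχv, smul_zero, sub_zero]
  have hδ'u : δ' u = 0 := by
    rw [hδ', LinearMap.sub_apply, LinearMap.smul_apply, smul_eq_mul,
      inv_mul_cancel_right₀ hχu, sub_self]
  refine ⟨δ', hδ'R, hδ'v ▸ h0, hδ'v ▸ h1, hδ'u, ?_⟩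
  obtain ⟨g, hg, hg'⟩ := hδ'R
  have hgu : g u = u := by rw [hg', hδ'u, zero_smul, add_zero]
  have h1' : δ' v ≠ 1 := hδ'v ▸ h1
  have hne : 1 + δ' v ≠ 0 := by
    intro h
    apply h1'
    have h2 : (2 : F4) = 0 := CharTwo.two_eq_zero
    linear_combination h - h2
  -- The reflection `g` fixes `u`, so conjugating by it yields another transvection at `u`. The two
  -- functionals differ by a nonzero multiple of `δ'`.
  have hcomp : Realizes G (g u) (ψ - ((1 + δ' v)⁻¹ * ψ v) • δ') := by
    refine hR.realizes_comp hg hψ fun w => ?_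
    rw [inv_apply hg' h1', map_sub, LinearMap.map_smul]
    simp only [LinearMap.sub_apply, LinearMap.smul_apply, smul_eq_mul]
    ring
  rw [hgu] at hcomp
  have hmem : ψ - ((1 + δ' v)⁻¹ * ψ v) • δ' ∈ hR.transvectionSubmodule hu :=
    (hR.mem_transvectionSubmodule hu).2 ⟨hcomp, by
      rw [LinearMap.sub_apply, LinearMap.smul_apply, hδ'u, hψu, smul_zero, sub_zero]⟩
  have := sub_mem ((hR.mem_transvectionSubmodule hu).2 ⟨hψ, hψu⟩) hmem
  rw [sub_sub_cancel] at this
  exact (Submodule.smul_mem_iff _ (mul_ne_zero (inv_ne_zero hne) hψv)).1 this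

/-- For independent `u` and `v`, a transvection functional at `v` is corrected by a multiple of the
functional `ε'` of a reflection at `u`, itself a transvection functional at `v`, so as to vanish at
`u`. It then belongs to a transvection at `u`. Symmetrically, some reflection at `v` has a
transvection functional at `u`, and all reflections at `v` lie in the span generated by any one of
them with the transvections. -/
theorem dualSubmodule_le (hR : IsReflectionConfiguration G) (hv : v ≠ 0) (hu : u ≠ 0)
    (hδ : Realizes G v δ) (h0 : δ v ≠ 0) (h1 : δ v ≠ 1)
    (hε : Realizes G u ε) (hε0 : ε u ≠ 0) (hε1 : ε u ≠ 1) :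
    hR.dualSubmodule hv δ ≤ hR.dualSubmodule hu ε := by
  by_cases huv : v ∈ Submodule.span F4 {u}
  · obtain ⟨c, rfl⟩ := Submodule.mem_span_singleton.1 huv
    have hc : c ≠ 0 := by rintro rfl; simp at hv
    exact hR.dualSubmodule_le_smul hu hε hε0 hε1 hc hv hδ h0 h1
  have hvu : u ∉ Submodule.span F4 {v} := by
    intro h
    obtain ⟨c, rfl⟩ := Submodule.mem_span_singleton.1 h
    have hc : c ≠ 0 := by rintro rfl; simp at hu
    exact huv (Submodule.mem_span_singleton.2 ⟨c⁻¹, by rw [smul_smul, inv_mul_cancel₀ hc,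
      one_smul]⟩)
  obtain ⟨δ', hδ', hδ'0, hδ'1, hδ'u, hδ'mem⟩ := hR.exists_reflection_mem hv hu hvu huv
  obtain ⟨ε', hε', hε'0, hε'1, hε'v, hε'mem⟩ := hR.exists_reflection_mem hu hv huv hvu
  have hA : hR.transvectionSubmodule hv ≤ hR.dualSubmodule hu ε := by
    intro χ hχ
    have hmem : χ - (χ u * (ε' u)⁻¹) • ε' ∈ hR.transvectionSubmodule hv :=
      sub_mem hχ (Submodule.smul_mem _ _ hε'mem)
    rw [hR.mem_transvectionSubmodule hv] at hmem
    have hzero : (χ - (χ u * (ε' u)⁻¹) • ε') u = 0 := by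
      rw [LinearMap.sub_apply, LinearMap.smul_apply, smul_eq_mul, inv_mul_cancel_right₀ hε'0,
        sub_self]
    obtain ⟨ψ, hψ, hψu, hψv⟩ := hR.exists_transvection u v hu huv
    have hψ' := (hR.mem_transvectionSubmodule hu).1 (Submodule.smul_mem _ (ψ v)⁻¹
      ((hR.mem_transvectionSubmodule hu).2 ⟨hψ, hψu⟩))
    have h2 := hR.realizes_of_apply_eq_zero hmem.1 hmem.2 hzero hψ'.1 hψ'.2
      (by rw [LinearMap.smul_apply, smul_eq_mul, inv_mul_cancel₀ hψv])
    have h3 := add_mem (Submodule.mem_sup_left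
      ((hR.mem_transvectionSubmodule hu).2 ⟨h2, hzero⟩))
      (Submodule.smul_mem _ (χ u * (ε' u)⁻¹)
        (hR.mem_dualSubmodule hu hε hε0 hε1 hε' hε'0 hε'1))
    rwa [sub_add_cancel] at h3
  have hsub : hR.dualSubmodule hv δ' ≤ hR.dualSubmodule hu ε :=
    sup_le hA ((Submodule.span_singleton_le_iff_mem _ _).2 (Submodule.mem_sup_left hδ'mem))
  exact sup_le hA ((Submodule.span_singleton_le_iff_mem _ _).2
    (hsub (hR.mem_dualSubmodule hv hδ' hδ'0 hδ'1 hδ h0 h1)))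

end IsReflectionConfiguration

/-! ### Identification of `G` with the reflection group -/

namespace IsLineConfiguration

variable {V : Type*} [AddCommGroup V] [Module (ZMod 2) V] [Module F4 V]
  [IsScalarTower (ZMod 2) F4 V]
  {G : Subgroup (V ≃ₗ[ZMod 2] V)} {D : Set (V ≃ₗ[ZMod 2] V)}
  {l m : Submodule (ZMod 2) V} {d g : V ≃ₗ[ZMod 2] V}

theorem exists_dual_of_centeredAt (hC : IsLineConfiguration G D)
    (hsmul : ∀ l ∈ dLines D, ∀ c : F4, ∀ v ∈ l, c • v ∈ l)
    (hlin : ∀ g ∈ G, ∀ (c : F4) (v : V), g (c • v) = c • g v)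
    (hd : d ∈ centeredAt D l) {v : V} (hv : v ∈ l) (hv0 : v ≠ 0) :
    ∃ δ : Module.Dual F4 V, (∀ w, d w = w + δ w • v) ∧ δ v ≠ 0 ∧ δ v ≠ 1 := by
  obtain ⟨δ, hδ⟩ := hC.exists_dual hsmul hlin (hC.mem_group hd) (mem_dLines_of_mem hd)
    (sub_mem_of_mem hd) hv hv0
  refine ⟨δ, hδ, fun h => ?_, fun h => ?_⟩
  · have := hδ v
    rw [h, zero_smul, add_zero] at this
    exact hv0 (hC.eq_zero_of_apply_eq hd hv this)
  · have := hδ v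
    rw [h, one_smul, ZModModule.add_self] at this
    exact hv0 (by simpa using this)

theorem isReflectionConfiguration (hC : IsLineConfiguration G D)
    (hall : ∀ l ∈ dLines D, ∀ m ∈ dLines D, l ≠ m → Moves G l m)
    (hcov : ∀ v : V, ∃ l ∈ dLines D, v ∈ l)
    (hsmul : ∀ l ∈ dLines D, ∀ c : F4, ∀ v ∈ l, c • v ∈ l)
    (hlin : ∀ g ∈ G, ∀ (c : F4) (v : V), g (c • v) = c • g v) :
    IsReflectionConfiguration G := by
  refine ⟨hlin, fun v hv0 => ?_, fun v u hv0 hu => ?_⟩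
  · obtain ⟨l, hl, hv⟩ := hcov v
    obtain ⟨d, hd⟩ := exists_mem_centeredAt hl
    obtain ⟨δ, hδ, h0, h1⟩ := hC.exists_dual_of_centeredAt hsmul hlin hd hv hv0
    exact ⟨δ, ⟨d, hC.mem_group hd, hδ⟩, h0, h1⟩
  · obtain ⟨l, hl, hv⟩ := hcov v
    obtain ⟨m, hm, hum⟩ := hcov u
    have hul : u ∉ l := by
      rw [hC.span_eq_ofSmulMem hl (hsmul l hl) hv hv0] at hu
      exact hu
    have hu0 : u ≠ 0 := by rintro rfl; exact hul l.zero_mem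
    obtain ⟨t, ht, htm⟩ := hall l hl m hm (by rintro rfl; exact hul hum)
    obtain ⟨χ, hχ⟩ := hC.exists_dual hsmul hlin ht.1 hl ht.2.1 hv hv0
    refine ⟨χ, ⟨t, ht.1, hχ⟩, ?_, fun h => ?_⟩
    · have := hχ v
      rw [mem_fixSpace.1 (ht.2.2 hv), left_eq_add] at this
      exact (smul_eq_zero.1 this).resolve_right hv0
    · refine hC.apply_ne (isAxial_of_transvections ht) hl hm htm hum hu0 ?_
      rw [hχ, h, zero_smul, add_zero]

/-- The group of a configuration in which transvections at each point move all others is a group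
generated by reflections. -/
theorem exists_eq_reflectionGroup (hC : IsLineConfiguration G D)
    (hall : ∀ l ∈ dLines D, ∀ m ∈ dLines D, l ≠ m → Moves G l m)
    (hcov : ∀ v : V, ∃ l ∈ dLines D, v ∈ l)
    (hsmul : ∀ l ∈ dLines D, ∀ c : F4, ∀ v ∈ l, c • v ∈ l)
    (hlin : ∀ g ∈ G, ∀ (c : F4) (v : V), g (c • v) = c • g v) :
    ∃ Φ : Submodule F4 (Module.Dual F4 V),
      (∀ v : V, (∀ φ ∈ Φ, φ v = 0) → v = 0) ∧
      G = (reflectionGroup Φ).map (restrictHom V) := by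
  have hR := hC.isReflectionConfiguration hall hcov hsmul hlin
  obtain ⟨l, hl, -⟩ := hcov 0
  obtain ⟨u, -, hu⟩ := hC.exists_ne_zero hl
  obtain ⟨ε, hε, hε0, hε1⟩ := hR.exists_reflection u hu
  have hmem : ∀ v : V, v ≠ 0 → ∀ δ, Realizes G v δ → δ v ≠ 0 → δ v ≠ 1 →
      δ ∈ hR.dualSubmodule hu ε := fun v hv δ hδ h0 h1 =>
    hR.dualSubmodule_le hv hu hδ h0 h1 hε hε0 hε1
      (hR.mem_dualSubmodule hv hδ h0 h1 hδ h0 h1)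
  -- The base vector `u` is arbitrary: the subspace contains the functional of a reflection at every
  -- nonzero `v`, so no such `v` is annihilated.
  refine ⟨hR.dualSubmodule hu ε, fun v hv => ?_, le_antisymm ?_ ?_⟩
  · by_contra hv0
    obtain ⟨δ, hδ, h0, h1⟩ := hR.exists_reflection v hv0
    exact h0 (hv δ (hmem v hv0 δ hδ h0 h1))
  · nth_rw 1 [← hC.closure_eq]
    rw [Subgroup.closure_le]
    intro d hd
    have hd' : d ∈ centeredAt D (commSpace d) := ⟨hd, rfl⟩
    obtain ⟨v, hv, hv0⟩ := hC.exists_ne_zero (mem_dLines_of_mem hd')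
    obtain ⟨δ, hδ, h0, h1⟩ := hC.exists_dual_of_centeredAt hsmul hlin hd' hv hv0
    have hdG := hC.mem_of_mem hd
    let d₄ : V ≃ₗ[F4] V := { d with map_smul' := hlin d hdG }
    refine ⟨d₄, Subgroup.subset_closure
      ⟨v, δ, hmem v hv0 δ ⟨d, hdG, hδ⟩ h0 h1, h0, h1, fun w => ?_⟩, ?_⟩
    · rw [ZModModule.sub_eq_add]
      exact hδ w
    · ext w
      rfl
  · rw [reflectionGroup, MonoidHom.map_closure, Subgroup.closure_le]
    rintro _ ⟨g, ⟨v, φ, hφ, h0, h1, hg⟩, rfl⟩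
    have hv0 : v ≠ 0 := by rintro rfl; simp at h0
    obtain ⟨δ, hδ, hδ0, hδ1⟩ := hR.exists_reflection v hv0
    -- Since the subspace is the same for every center, `φ` may be read as a functional at `v`,
    -- where its value other than `0` and `1` makes it the functional of an element of `G`.
    obtain ⟨f, hf, hf'⟩ := hR.realizes_of_mem_dualSubmodule hv0 hδ hδ0 hδ1
      (hR.dualSubmodule_le hu hv0 hε hε0 hε1 hδ hδ0 hδ1 hφ) h0 h1
    have : restrictHom V g = f := by
      ext w
      rw [hf', ← ZModModule.sub_eq_add]
      exact hg w
    rw [this]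
    exact hf

end IsLineConfiguration
end F2Group

open F2Group in
theorem theorem4p12 {V : Type*} [AddCommGroup V] [Module (ZMod 2) V]
    (G : Subgroup (V ≃ₗ[ZMod 2] V)) (D : Set (V ≃ₗ[ZMod 2] V))
    -- `G` is generated by the normal set `D`
    (hgen : Subgroup.closure D = G)
    (hnormal : ∀ g ∈ G, ∀ d ∈ D, g * d * g⁻¹ ∈ D)
    (horder : ∀ d ∈ D, orderOf d = 3)
    (hdim : ∀ d ∈ D, Module.finrank (ZMod 2) (commSpace d) = 2)
    -- `[V, G] = V` and `C_V(G) = 0`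
    (hcomm : groupCommSpace G = ⊤)
    (hfix : groupFixSpace G = ⊥)
    -- there are no `D`-points
    (hpoints : dPoints D = ∅)
    -- `G` is transitive on the `D`-lines
    (htrans : ∀ l ∈ dLines D, ∀ m ∈ dLines D, ∃ g ∈ G, l.map (g : V →ₗ[ZMod 2] V) = m)
    -- `Δ` is connected and contains a full spread
    (hconn : IsConnectedGeometry (dLines D) (deltaLines D))
    (hfull : ∃ S, IsFullSpread D S) :
    -- `Δ` is a projective space of order 4
    IsProjectiveSpaceOfOrder (dLines D) (deltaLines D) 4 ∧
    -- there is a structure `V₄` on `V` of a vector space over the field with four elements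
    ∃ (_ : Module F4 V) (_ : IsScalarTower (ZMod 2) F4 V),
      -- `Δ` is the projective space of `V₄`
      dLines D = {l | ∃ U : Submodule F4 V, Module.finrank F4 U = 1 ∧
        l = U.restrictScalars (ZMod 2)} ∧
      deltaLines D = {b | ∃ U : Submodule F4 V, Module.finrank F4 U = 2 ∧
        b = {l ∈ dLines D | l ≤ U.restrictScalars (ZMod 2)}} ∧
      -- `G` preserves this structure
      (∀ g ∈ G, ∀ (c : F4) (v : V), g (c • v) = c • g v) ∧
      -- `G` is `R(V₄, Φ)` for a subspace `Φ` of the dual of `V₄` annihilating `V₄`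
      ∃ Φ : Submodule F4 (Module.Dual F4 V),
        (∀ v : V, (∀ φ ∈ Φ, φ v = 0) → v = 0) ∧
        G = (reflectionGroup Φ).map (restrictHom V) := by
  have hC : IsLineConfiguration G D := ⟨hgen, hnormal, horder, hdim, hpoints⟩
  have hfix' : ∀ v, (∀ f ∈ D, f v = v) → v = 0 := by
    intro v hv
    have hle : v ∈ groupFixSpace G := by
      simp only [groupFixSpace, Submodule.mem_iInf]
      intro g hg
      rw [← hgen] at hg
      induction hg using Subgroup.closure_induction with
      | mem d hd => exact mem_fixSpace.2 (hv d hd)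
      | one => exact mem_fixSpace.2 rfl
      | mul a b _ _ iha ihb =>
        rw [mem_fixSpace] at iha ihb ⊢
        change a (b v) = v
        rw [ihb, iha]
      | inv a _ ih => rwa [fixSpace_inv]
    rwa [hfix, Submodule.mem_bot] at hle
  have hall : ∀ l ∈ dLines D, ∀ m ∈ dLines D, l ≠ m → Moves G l m := fun l hl m hm hlm =>
    hC.moves_of_ne htrans hfix' hconn hfull hl hm hlm
  have hne : (dLines D).Nonempty := by
    obtain ⟨S, W, hW, hSD⟩ := hfull
    obtain ⟨l, hl, -⟩ := IsLineConfiguration.exists_ne_of_isSpreadOf hW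
    exact ⟨l, hSD hl⟩
  have hcov := hC.exists_dLine_mem hall hcomm hne
  obtain ⟨M, hM, hsmul, hlin⟩ := hC.exists_module hall hcov
  exact ⟨hC.isProjectiveSpaceOfOrder hall, M, hM, hC.dLines_eq hcov hsmul,
    hC.deltaLines_eq_subspaces hall hcov hsmul, hlin,
    hC.exists_eq_reflectionGroup hall hcov hsmul hlin⟩
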